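/- **Setting.** A \emph{special 2-group} is a monoidal category $(\mathbb G,\otimes,I,a,l,r)$ whose underlying category is a skeletal groupoid, in which $l$ and $r$ are identities and every object is strictly invertible. Its objects form a group $\pi_0(\mathbb G)$ under $\otimes$, and $\pi_1(\mathbb G)=\mathrm{Aut}(I)$. For an object $g$ there are bijections $\gamma_g,\delta_g:\pi_1(\mathbb G)\to\mathrm{Aut}(g)$, $\gamma_g(u)=l_g(u\otimes \mathrm{id}_g)l_g^{-1}$, $\delta_g(u)=r_g(\mathrm{id}_g\otimes u)r_g^{-1}$; $\pi_0(\mathbb G)$ acts on $\pi_1(\mathbb G)$ by $g\cdot u=\gamma_g^{-1}(\delta_g(u))$, and $\alpha(g_1,g_2,g_3)=\gamma_{g_1g_2g_3}^{-1}(a_{g_1,g_2,g_3})\in\pi_1(\mathbb G)$. Let $\underline{\mathbb G}$ be the one-object bicategory with 1-morphisms the objects of $\mathbb G$, composed by $\otimes$. Let $\mathbf{2Mat}_{\mathbb C}$ be the 2-category with objects the natural numbers; 1-morphisms $n\to m$ the pairs $(\mathbf R,s)$ of a matrix $\mathbf R\in\mathrm{Mat}_{m\times n}(\mathbb N)$ and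 matrices $s_i(\mathbf a)\in GL(\mathbf R(\mathbf a)_i,\mathbb C)$ for $1\le i\le m$, $\mathbf a\in\mathbb N^n$, with $s_i(\mathbf e_j)=\mathrm I$; 2-morphisms $(\mathbf R,s)\Rightarrow(\mathbf R',s')$ the families of complex $R'_{ij}\times R_{ij}$ matrices $\mathsf T_{ij}$. Vertical composition is the entrywise matrix product. The composite $(\tilde{\mathbf R},\tilde s)\circ(\mathbf R,s)$ has rank matrix $\tilde{\mathbf R}\mathbf R$ and gauge $$\tilde s_k(\mathbf R(\mathbf a))\Big(\bigoplus_i \mathrm I_{\tilde R_{ki}}\otimes s_i(\mathbf a)\Big)\,\mathbf P(\tilde{\mathbf R}_k,\mathbf R,\mathbf a)\Big(\bigoplus_j\tilde s_k(\mathbf R(\mathbf e_j))^{-1}\otimes \mathrm I_{a_j}\Big),$$ where $\mathbf P(\tilde{\mathbf R}_k,\mathbf R,\mathbf a)$ is the permutation matrix of the canonical distributivity isomorphism $\bigoplus_j(\bigoplus_i\mathbb C^{\tilde R_{ki}}\otimes\mathbb C^{R_{ij}})\otimes\mathbb C^{a_j}\cong\bigoplus_i\mathbb C^{\tilde R_{ki}}\otimes(\bigoplus_j\mathbb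 C^{R_{ij}}\otimes\mathbb C^{a_j})$ in lexicographically ordered bases. The horizontal composite of $\tilde{\mathsf T}:(\tilde{\mathbf R},\tilde s)\Rightarrow(\tilde{\mathbf R}',\tilde s')$ and $\mathsf T:(\mathbf R,s)\Rightarrow(\mathbf R',s')$ has entries $\tilde s'_k(\mathbf R'(\mathbf e_j))\big(\bigoplus_i\tilde{\mathsf T}_{ki}\otimes\mathsf T_{ij}\big)\tilde s_k(\mathbf R(\mathbf e_j))^{-1}$. A \emph{nonzero 2-matrix representation} of $\mathbb G$ is a quadruple $(n,\rho,\beta,c)$ with $n\ge1$, $\rho:\pi_0(\mathbb G)\to S_n$ a group morphism, $\beta:\pi_1(\mathbb G)\to(\mathbb C^*)^n$ a group morphism with $\beta(g\cdot u)_i=\beta(u)_{\rho(g)^{-1}(i)}$, and $c:\pi_0(\mathbb G)^2\to(\mathbb C^*)^n$ with $c(e,g)=c(g,e)=1$ and $$c(g_2,g_3)_{\rho(g_1)^{-1}(i)}\,c(g_1g_2,g_3)_i^{-1}\,c(g_1,g_2g_3)_i\,c(g_1,g_2)_i^{-1}=\beta(\alpha(g_1,g_2,g_3))_i .$$ It is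 identified with the pseudofunctor $F:\underline{\mathbb G}\to\mathbf{2Mat}_{\mathbb C}$ sending the object to $n$, $g$ to the permutation matrix $\mathbf P(\rho(g))$ (entries $\delta_{i,\rho(g)(j)}$) with trivial gauge and $\varphi\in\mathrm{Aut}(g)$ to the 2-morphism with $(\rho(g)(j),j)$ entry $\beta(\gamma_g^{-1}(\varphi))_{\rho(g)(j)}$, with structure 2-isomorphisms $F(g_1)\circ F(g_2)\Rightarrow F(g_1g_2)$ having in row $i$ the entry $c(g_1,g_2)_i$, and identity unit 2-isomorphism. $\mathbf{Hom}$ denotes the category of pseudonatural transformations between two such pseudofunctors and modifications. Given representations $(n,\rho,\beta,c)$, $(n',\rho',\beta',c')$, let $\pi_0(\mathbb G)$ act on the right on $M(n',n)=\{1,\dots,n'\}\times\{1,\dots,n\}$ by $(i',i)\cdot g=(\rho'(g)^{-1}(i'),\rho(g)^{-1}(i))$. An orbit $\mathcal O$ is \emph{intertwining} if $\beta'(u)_{i'}=\beta(u)_i$ for all $(i',i)\in\mathcal O$, $u\in\pi_1(\mathbb G)$; then $z_{\mathcal O}(g_1,g_2)(i',i)=c'(g_1,g_2)_{i'}/c(g_1,g_2)_i$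 is a 2-cocycle of $\pi_0(\mathbb G)$ with values in the functions $\mathcal O\to\mathbb C^*$, with module structure $(g\cdot\lambda)(x)=\lambda(x\cdot g)$. Let $\mathbf{PBund}_{\pi_0(\mathbb G),z_{\mathcal O}}(\mathcal O)$ be the category whose objects are complex vector bundles $E\to\mathcal O$ (families of finite dimensional spaces $E_x$, $x\in\mathcal O$) with a projective right action, i.e. linear maps $\Theta(-,g):E_x\to E_{x\cdot g}$ with $\Theta(v,e)=v$ and $\Theta(v,g_1g_2)=z_{\mathcal O}(g_1,g_2)(x)\,\Theta(\Theta(v,g_1),g_2)$ for $v\in E_x$, and whose morphisms are the vector bundle morphisms over $\mathcal O$ commuting with the actions. **Theorem.** Let $\mathbb G$ be a special 2-group and let $(n,\rho,\beta,c)$ and $(n',\rho',\beta',c')$ be nonzero 2-matrix representations of $\mathbb G$. There is an equivalence of categories $$\mathbf{Hom}\big((n,\rho,\beta,c),(n',\rho',\beta',c')\big)\simeq\prod_{\mathcal O}\mathbf{PBund}_{\pi_0(\mathbb G),z_{\mathcal O}}(\mathcal O),$$ the product running over all intertwining $\pi_0(\mathbb G)$-orbits $\mathcal O$ of $M(n',n)$.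 In particular, if there are no intertwining orbits, the category on the left is equivalent to the terminal category $\mathbf 1$. -/

import Mathlib

universe v u

namespace TwoRep

open CategoryTheory Matrix MonoidalCategory
open scoped Kronecker

/-! ### Block matrices

`dot r a = ∑ j, r j * a j` is the dimension of `⨁ j, ℂ^(r j) ⊗ ℂ^(a j)`. -/

/-- The dimension of `⨁ j, ℂ^(r j) ⊗ ℂ^(a j)`. -/
abbrev dot {n : ℕ} (r a : Fin n → ℕ) : ℕ := ∑ j, r j * a j

theorem dot_congr {n : ℕ} {r r' a a' : Fin n → ℕ} (h : ∀ j, r j = r' j)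
    (h' : ∀ j, a j = a' j) : dot r a = dot r' a' := by
  rw [funext h, funext h']

/-- The lexicographic ordering `(j, x, y)` of the canonical basis of `⨁ j, ℂ^(r j) ⊗ ℂ^(a j)`. -/
def blockIdx {n : ℕ} (r a : Fin n → ℕ) :
    (Σ j, Fin (r j) × Fin (a j)) ≃ Fin (dot r a) :=
  (Equiv.sigmaCongrRight fun _ => finProdFinEquiv).trans finSigmaFinEquiv

/-- The matrix `⨁ j, A j ⊗ B j`: block diagonal, with blocks the Kronecker products. -/
def blockTensor {n : ℕ} {r r' a a' : Fin n → ℕ}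
    (A : ∀ j, Matrix (Fin (r' j)) (Fin (r j)) ℂ) (B : ∀ j, Matrix (Fin (a' j)) (Fin (a j)) ℂ) :
    Matrix (Fin (dot r' a')) (Fin (dot r a)) ℂ :=
  Matrix.reindex (blockIdx r' a') (blockIdx r a)
    (Matrix.blockDiagonal' fun j => A j ⊗ₖ B j)

/-- The matrix of the bijection `e` between canonical bases. -/
def permMat {p q : ℕ} (e : Fin p ≃ Fin q) : Matrix (Fin q) (Fin p) ℂ :=
  (1 : Matrix (Fin q) (Fin q) ℂ).submatrix id e

/-- The identity matrix, seen with rows and columns indexed by equal numbers. -/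
def castMat {p q : ℕ} (h : p = q) : Matrix (Fin q) (Fin p) ℂ := permMat (finCongr h)

/-- The canonical permutation `P(r, R, a)`, that is, the distributivity and associativity bijection
between the lexicographically ordered canonical bases
`⨁ j, (⨁ i, ℂ^(r i) ⊗ ℂ^(R i j)) ⊗ ℂ^(a j) ≅ ⨁ i, ℂ^(r i) ⊗ (⨁ j, ℂ^(R i j) ⊗ ℂ^(a j))`. -/
def exchange {m n : ℕ} (r : Fin m → ℕ) (R : Fin m → Fin n → ℕ) (a : Fin n → ℕ) :
    Fin (dot (fun j => dot r (fun i => R i j)) a) ≃ Fin (dot r (fun i => dot (R i) a)) :=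
  (blockIdx _ a).symm.trans <|
  (Equiv.sigmaCongrRight fun j =>
    Equiv.prodCongr (blockIdx r (fun i => R i j)).symm (Equiv.refl _)).trans <|
  Equiv.trans
    { toFun := fun p => ⟨p.2.1.1, p.2.1.2.1, ⟨p.1, p.2.1.2.2, p.2.2⟩⟩
      invFun := fun q => ⟨q.2.2.1, ⟨q.1, q.2.1, q.2.2.2.1⟩, q.2.2.2.2⟩
      left_inv := fun _ => rfl
      right_inv := fun _ => rfl } <|
  (Equiv.sigmaCongrRight fun i =>
    Equiv.prodCongr (Equiv.refl _) (blockIdx (R i) a)).trans <|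
  blockIdx r _

theorem exchange_apply {m n : ℕ} (r : Fin m → ℕ) (R : Fin m → Fin n → ℕ) (a : Fin n → ℕ)
    (i : Fin m) (j : Fin n) (x : Fin (r i)) (y : Fin (R i j)) (z : Fin (a j)) :
    exchange r R a (blockIdx _ a ⟨j, blockIdx r (fun i => R i j) ⟨i, x, y⟩, z⟩) =
      blockIdx r _ ⟨i, x, blockIdx (R i) a ⟨j, y, z⟩⟩ := by
  simp [exchange]

theorem permMat_mul {p q l : ℕ} (e : Fin p ≃ Fin q) (M : Matrix (Fin p) (Fin l) ℂ) :
    permMat e * M = M.submatrix e.symm id := by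
  ext i j
  rw [Matrix.mul_apply, Finset.sum_eq_single (e.symm i)]
  · change (1 : Matrix (Fin q) (Fin q) ℂ) i (e (e.symm i)) * _ = _
    rw [Equiv.apply_symm_apply, one_apply_eq, one_mul]
    rfl
  · intro b _ hb
    have : i ≠ e b := fun h => hb (by simp [h])
    simp [permMat, this]
  · simp

theorem mul_permMat {p q l : ℕ} (e : Fin p ≃ Fin q) (M : Matrix (Fin l) (Fin q) ℂ) :
    M * permMat e = M.submatrix id e := by
  ext i j
  simp [permMat, Matrix.mul_apply, Matrix.one_apply]

theorem permMat_mul_permMat {p q l : ℕ} (e : Fin p ≃ Fin q) (e' : Fin q ≃ Fin l) :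
    permMat e' * permMat e = permMat (e.trans e') := by
  rw [mul_permMat]; rfl

@[simp] theorem permMat_refl {p : ℕ} : permMat (Equiv.refl (Fin p)) = 1 := rfl

theorem permMat_finCongr {p q : ℕ} (h : p = q) : permMat (finCongr h) = castMat h := rfl

@[simp] theorem castMat_rfl {p : ℕ} (h : p = p) : castMat h = 1 := rfl

@[simp] theorem permMat_symm_mul {p q : ℕ} (e : Fin p ≃ Fin q) :
    permMat e.symm * permMat e = 1 := by
  rw [permMat_mul_permMat]; simp

@[simp] theorem permMat_mul_symm {p q : ℕ} (e : Fin p ≃ Fin q) :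
    permMat e * permMat e.symm = 1 := by
  rw [permMat_mul_permMat]; simp

@[simp] theorem castMat_mul {p q l : ℕ} (h : p = q) (h' : q = l) :
    castMat h' * castMat h = castMat (h.trans h') := by
  subst h; subst h'; simp

theorem blockTensor_apply_same {n : ℕ} {r r' a a' : Fin n → ℕ}
    (A : ∀ j, Matrix (Fin (r' j)) (Fin (r j)) ℂ) (B : ∀ j, Matrix (Fin (a' j)) (Fin (a j)) ℂ)
    (j : Fin n) (x' : Fin (r' j)) (x : Fin (r j)) (y' : Fin (a' j)) (y : Fin (a j)) :
    blockTensor A B (blockIdx r' a' ⟨j, x', y'⟩) (blockIdx r a ⟨j, x, y⟩) =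
      A j x' x * B j y' y := by
  simp [blockTensor]

theorem blockTensor_apply_ne {n : ℕ} {r r' a a' : Fin n → ℕ}
    (A : ∀ j, Matrix (Fin (r' j)) (Fin (r j)) ℂ) (B : ∀ j, Matrix (Fin (a' j)) (Fin (a j)) ℂ)
    {j j' : Fin n} (h : j' ≠ j) (p' : Fin (r' j') × Fin (a' j')) (p : Fin (r j) × Fin (a j)) :
    blockTensor A B (blockIdx r' a' ⟨j', p'⟩) (blockIdx r a ⟨j, p⟩) = 0 := by
  simp [blockTensor, Matrix.blockDiagonal'_apply, h]

theorem blockTensor_mul {n : ℕ} {r r' r'' a a' a'' : Fin n → ℕ}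
    (A' : ∀ j, Matrix (Fin (r'' j)) (Fin (r' j)) ℂ) (B' : ∀ j, Matrix (Fin (a'' j)) (Fin (a' j)) ℂ)
    (A : ∀ j, Matrix (Fin (r' j)) (Fin (r j)) ℂ) (B : ∀ j, Matrix (Fin (a' j)) (Fin (a j)) ℂ) :
    blockTensor A' B' * blockTensor A B =
      blockTensor (fun j => A' j * A j) (fun j => B' j * B j) := by
  simp only [blockTensor, Matrix.reindex_apply, Matrix.submatrix_mul_equiv,
    ← Matrix.blockDiagonal'_mul, Matrix.mul_kronecker_mul]

theorem blockTensor_one {n : ℕ} (r a : Fin n → ℕ) :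
    blockTensor (r := r) (r' := r) (a := a) (a' := a) (fun _ => 1) (fun _ => 1) = 1 := by
  have h : (Matrix.blockDiagonal' fun j =>
      (1 : Matrix (Fin (r j)) (Fin (r j)) ℂ) ⊗ₖ (1 : Matrix (Fin (a j)) (Fin (a j)) ℂ)) = 1 := by
    simp only [Matrix.one_kronecker_one]
    exact Matrix.blockDiagonal'_one
  simp only [blockTensor, h]
  simp

theorem blockIdx_cases {n : ℕ} {r a : Fin n → ℕ} {P : Fin (dot r a) → Prop}
    (h : ∀ j x y, P (blockIdx r a ⟨j, x, y⟩)) (p) : P p := by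
  obtain ⟨⟨j, x, y⟩, rfl⟩ := (blockIdx r a).surjective p
  exact h j x y

theorem blockTensor_exchange {m n : ℕ} {r r' : Fin m → ℕ} {R R' : Fin m → Fin n → ℕ}
    {a a' : Fin n → ℕ} (A : ∀ i, Matrix (Fin (r' i)) (Fin (r i)) ℂ)
    (B : ∀ i j, Matrix (Fin (R' i j)) (Fin (R i j)) ℂ)
    (C : ∀ j, Matrix (Fin (a' j)) (Fin (a j)) ℂ) :
    blockTensor A (fun i => blockTensor (B i) C) * permMat (exchange r R a) =
      permMat (exchange r' R' a') * blockTensor (fun j => blockTensor A (fun i => B i j)) C := by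
  rw [mul_permMat, permMat_mul]
  ext p q
  obtain ⟨p, rfl⟩ := (exchange r' R' a').surjective p
  simp only [submatrix_apply, id_eq, Equiv.symm_apply_apply]
  induction p using blockIdx_cases with | _ j' u' z'
  induction u' using blockIdx_cases with | _ i' x' y'
  induction q using blockIdx_cases with | _ j u z
  induction u using blockIdx_cases with | _ i x y
  rw [exchange_apply, exchange_apply]
  by_cases hi : i' = i
  · subst hi
    rw [blockTensor_apply_same]
    by_cases hj : j' = j
    · subst hj
      rw [blockTensor_apply_same, blockTensor_apply_same, blockTensor_apply_same, mul_assoc]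
    · rw [blockTensor_apply_ne _ _ hj, blockTensor_apply_ne _ _ hj, mul_zero]
  · rw [blockTensor_apply_ne _ _ hi]
    by_cases hj : j' = j
    · subst hj
      rw [blockTensor_apply_same, blockTensor_apply_ne _ _ hi, zero_mul]
    · rw [blockTensor_apply_ne _ _ hj]

/-- The bijection of canonical bases given by bijections of the blocks. -/
def blockPerm {n : ℕ} {r r' a a' : Fin n → ℕ} (e : ∀ j, Fin (r j) ≃ Fin (r' j))
    (f : ∀ j, Fin (a j) ≃ Fin (a' j)) : Fin (dot r a) ≃ Fin (dot r' a') :=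
  (blockIdx r a).symm.trans <|
  (Equiv.sigmaCongrRight fun j => Equiv.prodCongr (e j) (f j)).trans (blockIdx r' a')

theorem blockPerm_apply {n : ℕ} {r r' a a' : Fin n → ℕ} (e : ∀ j, Fin (r j) ≃ Fin (r' j))
    (f : ∀ j, Fin (a j) ≃ Fin (a' j)) (j x y) :
    blockPerm e f (blockIdx r a ⟨j, x, y⟩) = blockIdx r' a' ⟨j, e j x, f j y⟩ := by
  simp [blockPerm]

theorem blockTensor_permMat {n : ℕ} {r r' a a' : Fin n → ℕ} (e : ∀ j, Fin (r j) ≃ Fin (r' j))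
    (f : ∀ j, Fin (a j) ≃ Fin (a' j)) :
    blockTensor (fun j => permMat (e j)) (fun j => permMat (f j)) = permMat (blockPerm e f) := by
  ext p q
  obtain ⟨p, rfl⟩ := (blockPerm e f).surjective p
  induction p using blockIdx_cases with | _ j' x' y'
  induction q using blockIdx_cases with | _ j x y
  simp only [permMat, submatrix_apply, id, one_apply, EmbeddingLike.apply_eq_iff_eq]
  rw [blockPerm_apply]
  by_cases hj : j' = j
  · subst hj
    rw [blockTensor_apply_same]
    simp [one_apply, ← ite_and, and_comm]
  · rw [blockTensor_apply_ne _ _ hj]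
    simp [hj]

theorem blockTensor_castMat {n : ℕ} {r r' a a' : Fin n → ℕ} (h : ∀ j, r j = r' j)
    (h' : ∀ j, a j = a' j) :
    blockTensor (fun j => castMat (h j)) (fun j => castMat (h' j)) =
      castMat (by simp only [dot, h, h']) := by
  obtain rfl : r = r' := funext h
  obtain rfl : a = a' := funext h'
  exact blockTensor_one r a

/-- The vector `e_j`. -/
abbrev stdVec {n : ℕ} (j : Fin n) : Fin n → ℕ := fun i => if i = j then 1 else 0
/-- The `j`-th row of the identity matrix. -/
abbrev stdRow {n : ℕ} (j : Fin n) : Fin n → ℕ := fun i => if j = i then 1 else 0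

theorem dot_stdVec {n : ℕ} (r : Fin n → ℕ) (j : Fin n) : dot r (stdVec j) = r j := by simp [dot]
theorem dot_stdRow {n : ℕ} (a : Fin n → ℕ) (j : Fin n) : dot (stdRow j) a = a j := by simp [dot]

theorem eq_of_fin_stdVec {n : ℕ} {i j : Fin n} (y : Fin (stdVec j i)) : i = j := by
  by_contra h
  have := y.pos
  simp [stdVec, h] at this

theorem eq_of_fin_stdRow {n : ℕ} {i j : Fin n} (y : Fin (stdRow i j)) : i = j := by
  by_contra h
  have := y.pos
  simp [stdRow, h] at this

theorem blockIdx_stdVec {n : ℕ} (r : Fin n → ℕ) (j : Fin n) (x : Fin (r j)) (y) :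
    blockIdx r (stdVec j) ⟨j, x, y⟩ = Fin.cast (dot_stdVec r j).symm x := by
  ext
  have hy : (y : ℕ) < 1 := lt_of_lt_of_eq y.2 (by simp)
  have h0 : ∀ i : Fin j, Fin.castLE j.2.le i ≠ j := fun i h => by
    have := congrArg Fin.val h; simp at this; omega
  simp [blockIdx, finSigmaFinEquiv_apply, h0]
  omega

theorem blockIdx_stdRow {n : ℕ} (a : Fin n → ℕ) (j : Fin n) (x) (y : Fin (a j)) :
    blockIdx (stdRow j) a ⟨j, x, y⟩ = Fin.cast (dot_stdRow a j).symm y := by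
  ext
  have hx : (x : ℕ) < 1 := lt_of_lt_of_eq x.2 (by simp)
  have h0 : ∀ i : Fin j, j ≠ Fin.castLE j.2.le i := fun i h => by
    have := congrArg Fin.val h; simp at this; omega
  simp [blockIdx, finSigmaFinEquiv_apply, h0]
  right; omega

theorem blockTensor_stdVec {n : ℕ} {r r' : Fin n → ℕ} (j : Fin n)
    (A : ∀ i, Matrix (Fin (r' i)) (Fin (r i)) ℂ) :
    blockTensor (a := stdVec j) (a' := stdVec j) A (fun _ => 1) =
      castMat (dot_stdVec r' j).symm * A j * castMat (dot_stdVec r j) := by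
  rw [castMat, castMat, permMat_mul, mul_permMat]
  ext p q
  induction p using blockIdx_cases with | _ j' x' y'
  induction q using blockIdx_cases with | _ i x y
  have h1 : j' = j := eq_of_fin_stdVec y'
  have h2 : i = j := eq_of_fin_stdVec y
  subst h1; subst h2
  rw [blockTensor_apply_same, blockIdx_stdVec, blockIdx_stdVec]
  have : y' = y := by
    ext; have := lt_of_lt_of_eq y.2 (show _ = 1 by simp)
    have := lt_of_lt_of_eq y'.2 (show _ = 1 by simp)
    omega
  subst this
  simp

theorem blockTensor_stdRow {n : ℕ} {a a' : Fin n → ℕ} (j : Fin n)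
    (B : ∀ i, Matrix (Fin (a' i)) (Fin (a i)) ℂ) :
    blockTensor (r := stdRow j) (r' := stdRow j) (fun _ => 1) B =
      castMat (dot_stdRow a' j).symm * B j * castMat (dot_stdRow a j) := by
  rw [castMat, castMat, permMat_mul, mul_permMat]
  ext p q
  induction p using blockIdx_cases with | _ j' x' y'
  induction q using blockIdx_cases with | _ i x y
  have h1 : j = j' := eq_of_fin_stdRow x'
  have h2 : j = i := eq_of_fin_stdRow x
  subst h1; subst h2
  rw [blockTensor_apply_same, blockIdx_stdRow, blockIdx_stdRow]
  have : x' = x := by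
    ext; have := lt_of_lt_of_eq x.2 (show _ = 1 by simp)
    have := lt_of_lt_of_eq x'.2 (show _ = 1 by simp)
    omega
  subst this
  simp

theorem exchange_pentagon {l m n : ℕ} (r : Fin l → ℕ) (S : Fin l → Fin m → ℕ)
    (R : Fin m → Fin n → ℕ) (a : Fin n → ℕ) (p) :
    exchange r S (fun i => dot (R i) a)
        (exchange (fun i => dot r (fun k => S k i)) R a p) =
      blockPerm (fun _ => Equiv.refl _) (fun k => exchange (S k) R a)
        (exchange r (fun k j => dot (S k) (fun i => R i j)) a
          (blockPerm (fun j => exchange r S (fun i => R i j)) (fun _ => Equiv.refl _) p)) := by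
  induction p using blockIdx_cases with | _ j u z
  induction u using blockIdx_cases with | _ i u y
  induction u using blockIdx_cases with | _ k w x
  simp only [exchange_apply, blockPerm_apply, Equiv.refl_apply]

theorem blockIdx_cast {n : ℕ} {r r' a a' : Fin n → ℕ} (h : ∀ j, r j = r' j)
    (h' : ∀ j, a j = a' j) (j) (x : Fin (r j)) (y : Fin (a j)) :
    blockIdx r' a' ⟨j, Fin.cast (h j) x, Fin.cast (h' j) y⟩ =
      Fin.cast (by simp only [dot, h, h']) (blockIdx r a ⟨j, x, y⟩) := by
  obtain rfl : r = r' := funext h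
  obtain rfl : a = a' := funext h'
  rfl

theorem exchange_stdVec {m n : ℕ} (r : Fin m → ℕ) (R : Fin m → Fin n → ℕ) (j : Fin n)
    (h) : exchange r R (stdVec j) = finCongr h := by
  refine Equiv.ext fun p => ?_
  induction p using blockIdx_cases with | _ j' u z
  obtain rfl : j' = j := eq_of_fin_stdVec z
  induction u using blockIdx_cases with | _ i x y
  rw [exchange_apply, blockIdx_stdVec, blockIdx_stdVec]
  exact blockIdx_cast (fun _ => rfl) (fun i => (dot_stdVec (R i) j').symm) i x y

theorem exchange_stdRow {m n : ℕ} (k : Fin m) (R : Fin m → Fin n → ℕ) (a : Fin n → ℕ)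
    (h) : exchange (stdRow k) R a = finCongr h := by
  refine Equiv.ext fun p => ?_
  induction p using blockIdx_cases with | _ j u z
  induction u using blockIdx_cases with | _ i x y
  obtain rfl : k = i := eq_of_fin_stdRow x
  rw [exchange_apply, blockIdx_stdRow, blockIdx_stdRow]
  rw [show blockIdx (fun j => dot (stdRow k) (fun i => R i j)) a ⟨j, Fin.cast _ y, z⟩ = _ from
    blockIdx_cast (fun j => (dot_stdRow (fun i => R i j) k).symm) (fun _ => rfl) j y z]
  rfl

theorem exchange_id {n : ℕ} (r : Fin n → ℕ) (a : Fin n → ℕ)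
    (h) : exchange r stdRow a = finCongr h := by
  refine Equiv.ext fun p => ?_
  induction p using blockIdx_cases with | _ j u z
  induction u using blockIdx_cases with | _ i x y
  obtain rfl : i = j := eq_of_fin_stdRow y
  rw [exchange_apply, blockIdx_stdRow]
  rw [show blockIdx r (fun i' => stdRow i' i) ⟨i, x, y⟩ = _ from blockIdx_stdVec r i x y]
  rw [show blockIdx r (fun i => dot (stdRow i) a) ⟨i, x, Fin.cast _ z⟩ = _ from
    blockIdx_cast (fun _ => rfl) (fun i => (dot_stdRow a i).symm) i x z]
  rw [show blockIdx (fun j => dot r fun i => stdRow i j) a ⟨i, Fin.cast _ x, z⟩ = _ from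
    blockIdx_cast (fun i => (dot_stdVec r i).symm) (fun _ => rfl) i x z]
  rfl


/-! ### The 2-category of 2-matrices -/

/-- 1-morphisms `n → m` of `2Mat`: an `m × n` matrix `rank` of natural numbers together with a
gauge, i.e. invertible matrices `gauge i a` of size `(rank · a)_i` for every vector `a`,
normalized to be the identity on the canonical vectors `e_j`. -/
structure Mor (n m : ℕ) where
  rank : Fin m → Fin n → ℕ
  gauge : ∀ (i : Fin m) (a : Fin n → ℕ), GL (Fin (dot (rank i) a)) ℂ
  gauge_stdVec : ∀ i j, gauge i (stdVec j) = 1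

namespace Mor
variable {n m p q : ℕ}

/-- The vector `R(a)`. -/
abbrev app (f : Mor n m) (a : Fin n → ℕ) : Fin m → ℕ := fun i => dot (f.rank i) a

/-- The `j`-th column `R(e_j)` of the rank matrix. -/
abbrev col (f : Mor n m) (j : Fin n) : Fin m → ℕ := fun i => f.rank i j

/-- The product of the rank matrices. -/
abbrev compRank (f : Mor n m) (g : Mor m p) : Fin p → Fin n → ℕ :=
  fun k j => dot (g.rank k) (f.col j)

theorem dot_compRank (f : Mor n m) (g : Mor m p) (k : Fin p) (a : Fin n → ℕ) :
    dot (g.rank k) (f.app a) = dot (f.compRank g k) a := by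
  simp only [dot, app, compRank, col, Finset.mul_sum, Finset.sum_mul]
  rw [Finset.sum_comm]
  simp only [mul_assoc]

theorem gauge_inv_mul (f : Mor n m) (i a) :
    ((f.gauge i a)⁻¹).1 * (f.gauge i a).1 = 1 := by
  rw [← Units.val_mul]; simp

theorem gauge_mul_inv (f : Mor n m) (i a) :
    (f.gauge i a).1 * ((f.gauge i a)⁻¹).1 = 1 := by
  rw [← Units.val_mul]; simp

/-- The gauge of the composite `g ∘ f`, before identifying the numbers `(S(R(a)))_k` and
`((S R)(a))_k`. With `(R, s)` the data of `f` and `(S, t)` those of `g`, this is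
`t_k(R(a)) (⨁ i, I ⊗ s_i(a)) P(S_k, R, a) (⨁ j, t_k(R(e_j))⁻¹ ⊗ I)`. -/
def compGaugeMat (f : Mor n m) (g : Mor m p) (k : Fin p) (a : Fin n → ℕ) :
    Matrix (Fin (dot (g.rank k) (f.app a))) (Fin (dot (f.compRank g k) a)) ℂ :=
  (g.gauge k (f.app a)).1
    * blockTensor (r := g.rank k) (r' := g.rank k) (a := f.app a) (a' := f.app a)
        (fun _ => 1) (fun i => (f.gauge i a).1)
    * permMat (exchange (g.rank k) f.rank a)
    * blockTensor (r := f.compRank g k) (r' := f.compRank g k) (a := a) (a' := a)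
        (fun j => ((g.gauge k (f.col j))⁻¹).1) (fun _ => 1)

/-- The inverse of `compGaugeMat`. -/
def compGaugeInv (f : Mor n m) (g : Mor m p) (k : Fin p) (a : Fin n → ℕ) :
    Matrix (Fin (dot (f.compRank g k) a)) (Fin (dot (g.rank k) (f.app a))) ℂ :=
  blockTensor (r := f.compRank g k) (r' := f.compRank g k) (a := a) (a' := a)
        (fun j => (g.gauge k (f.col j)).1) (fun _ => 1)
    * (permMat (exchange (g.rank k) f.rank a).symm
    * (blockTensor (r := g.rank k) (r' := g.rank k) (a := f.app a) (a' := f.app a)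
        (fun _ => 1) (fun i => ((f.gauge i a)⁻¹).1)
    * ((g.gauge k (f.app a))⁻¹).1))

theorem mul3_assoc {a b c d : ℕ} (A : Matrix (Fin a) (Fin b) ℂ) (B : Matrix (Fin b) (Fin c) ℂ)
    {C : Matrix (Fin a) (Fin c) ℂ} (h : A * B = C) (D : Matrix (Fin c) (Fin d) ℂ) :
    A * (B * D) = C * D := by rw [← Matrix.mul_assoc, h]

theorem compGaugeMat_mul_inv (f : Mor n m) (g : Mor m p) (k a) :
    compGaugeMat f g k a * compGaugeInv f g k a = 1 := by
  simp only [compGaugeMat, compGaugeInv, Matrix.mul_assoc]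
  rw [mul3_assoc _ _ (blockTensor_mul _ _ _ _)]
  simp only [gauge_inv_mul, Matrix.mul_one, blockTensor_one, Matrix.one_mul]
  rw [mul3_assoc _ _ (permMat_mul_symm _), Matrix.one_mul,
    mul3_assoc _ _ (blockTensor_mul _ _ _ _)]
  simp only [gauge_mul_inv, Matrix.mul_one, blockTensor_one, Matrix.one_mul]

theorem compGaugeInv_mul (f : Mor n m) (g : Mor m p) (k a) :
    compGaugeInv f g k a * compGaugeMat f g k a = 1 := by
  simp only [compGaugeMat, compGaugeInv, Matrix.mul_assoc]
  rw [mul3_assoc _ _ (gauge_inv_mul _ _ _), Matrix.one_mul,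
    mul3_assoc _ _ (blockTensor_mul _ _ _ _)]
  simp only [gauge_inv_mul, Matrix.mul_one, blockTensor_one, Matrix.one_mul]
  rw [mul3_assoc _ _ (permMat_symm_mul _), Matrix.one_mul, blockTensor_mul]
  simp only [gauge_mul_inv, Matrix.mul_one, blockTensor_one]

/-- The gauge of the composite `g ∘ f`. -/
def compGauge (f : Mor n m) (g : Mor m p) (k : Fin p) (a : Fin n → ℕ) :
    GL (Fin (dot (f.compRank g k) a)) ℂ where
  val := castMat (dot_compRank f g k a) * compGaugeMat f g k a
  inv := compGaugeInv f g k a * castMat (dot_compRank f g k a).symm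
  val_inv := by
    rw [Matrix.mul_assoc, mul3_assoc _ _ (compGaugeMat_mul_inv f g k a)]
    simp
  inv_val := by
    rw [Matrix.mul_assoc, mul3_assoc _ _ (castMat_mul _ _)]
    simp [compGaugeInv_mul]

theorem gauge_congr (f : Mor n m) (i) {a b : Fin n → ℕ} (h : ∀ j, a j = b j) :
    (f.gauge i b).1 =
      (castMat (dot_congr (fun _ => rfl) h) :
        Matrix (Fin (dot (f.rank i) b)) (Fin (dot (f.rank i) a)) ℂ) * (f.gauge i a).1 *
      (castMat (dot_congr (fun _ => rfl) fun j => (h j).symm) :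
        Matrix (Fin (dot (f.rank i) a)) (Fin (dot (f.rank i) b)) ℂ) := by
  obtain rfl : a = b := funext h
  simp

/-- The composite `g ∘ f` of `f : n → m` and `g : m → p`. -/
abbrev comp (f : Mor n m) (g : Mor m p) : Mor n p where
  rank := f.compRank g
  gauge := f.compGauge g
  gauge_stdVec k j := by
    have h1 : ∀ i, f.col j i = f.app (stdVec j) i := fun i => (dot_stdVec (f.rank i) j).symm
    have h2 : (fun i => (f.gauge i (stdVec j)).1) = fun i => 1 := by
      funext i; rw [f.gauge_stdVec]; rfl
    ext : 1
    have h3 := exchange_stdVec (g.rank k) f.rank j (dot_compRank f g k _).symm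
    have h0 : (f.compGauge g k (stdVec j)).1 =
      castMat (dot_compRank f g k (stdVec j)) * compGaugeMat f g k (stdVec j) := rfl
    rw [h0, compGaugeMat, h2, blockTensor_one, Matrix.mul_one, blockTensor_stdVec, h3,
      permMat_finCongr, gauge_congr g k h1]
    simp only [Matrix.mul_assoc]
    rw [mul3_assoc _ _ (castMat_mul _ _), mul3_assoc _ _ (castMat_mul _ _),
      mul3_assoc _ _ (castMat_mul _ _), castMat_rfl, Matrix.one_mul,
      mul3_assoc _ _ (gauge_mul_inv _ _ _), Matrix.one_mul, castMat_mul, castMat_rfl]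
    rfl

theorem comp_gauge (f : Mor n m) (g : Mor m p) (k a) : ((f.comp g).gauge k a).1 =
  castMat (dot_compRank f g k a) * compGaugeMat f g k a := rfl

theorem comp_gauge_inv (f : Mor n m) (g : Mor m p) (k a) : (((f.comp g).gauge k a)⁻¹).1 =
  compGaugeInv f g k a * castMat (dot_compRank f g k a).symm := rfl

/-- The 1-morphism with given rank matrix and trivial gauge. -/
abbrev ofRank (R : Fin m → Fin n → ℕ) : Mor n m := ⟨R, fun _ _ => 1, fun _ _ => rfl⟩

/-- The identity 1-morphism. -/
abbrev id (n : ℕ) : Mor n n := ofRank stdRow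

theorem ext' {f g : Mor n m} (h : ∀ i j, f.rank i j = g.rank i j)
    (h' : ∀ i a, (f.gauge i a).1 * (castMat (dot_congr (fun j => (h i j).symm) fun _ => rfl) :
        Matrix (Fin (dot (f.rank i) a)) (Fin (dot (g.rank i) a)) ℂ) =
      (castMat (dot_congr (fun j => (h i j).symm) fun _ => rfl) :
        Matrix (Fin (dot (f.rank i) a)) (Fin (dot (g.rank i) a)) ℂ) * (g.gauge i a).1) :
    f = g := by
  obtain ⟨R, s, hs⟩ := f
  obtain ⟨R', s', hs'⟩ := g
  obtain rfl : R = R' := by ext; exact h _ _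
  congr
  funext i a
  ext : 1
  simpa using h' i a

theorem id_comp (f : Mor n m) : (id n).comp f = f := by
  refine ext' (fun i j => dot_stdVec _ _) fun i a => ?_
  rw [comp_gauge]
  have h1 : (fun i => ((id n).gauge i a).1) = fun i => 1 := rfl
  have h2 : (fun j => ((f.gauge i ((id n).col j))⁻¹).1) = fun j => 1 := by
    funext j
    rw [show f.gauge i ((id n).col j) = 1 from f.gauge_stdVec i j]
    simp
  have h3 := exchange_id (f.rank i) a (dot_compRank (id n) f i _).symm
  have h4 : ∀ j, a j = (id n).app a j := fun j => (dot_stdRow a j).symm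
  rw [compGaugeMat, h1, h2, blockTensor_one, blockTensor_one, Matrix.mul_one, Matrix.mul_one,
    h3, permMat_finCongr, gauge_congr f i h4]
  simp only [Matrix.mul_assoc]
  rw [mul3_assoc _ _ (castMat_mul _ _)]
  simp only [castMat_mul]
  rw [castMat_rfl, Matrix.mul_one]

theorem comp_id (f : Mor n m) : f.comp (id m) = f := by
  refine ext' (fun i j => dot_stdRow _ _) fun i a => ?_
  rw [comp_gauge]
  have h2 : (fun j => (((id m).gauge i (f.col j))⁻¹).1) = fun j => 1 := by
    funext j
    rw [show (id m).gauge i (f.col j) = 1 from rfl]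
    simp
  have h3 := exchange_stdRow i f.rank a (dot_compRank f (id m) i _).symm
  rw [compGaugeMat, h2, blockTensor_one, Matrix.mul_one,
    show ((id m).gauge i (f.app a)).1 = 1 from rfl, Matrix.one_mul]
  rw [h3, permMat_finCongr, blockTensor_stdRow]
  simp only [Matrix.mul_assoc, castMat_mul]
  rw [mul3_assoc _ _ (castMat_mul _ _)]
  rw [castMat_rfl, Matrix.mul_one]

theorem gauge_blockTensor_cast (f : Mor n m) (i) {a b : Fin n → ℕ} (h : ∀ j, a j = b j) :
    (f.gauge i b).1 * blockTensor (r := f.rank i) (r' := f.rank i) (fun _ => 1)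
      (fun j => castMat (h j)) =
      (castMat (dot_congr (fun _ => rfl) h) :
        Matrix (Fin (dot (f.rank i) b)) (Fin (dot (f.rank i) a)) ℂ) * (f.gauge i a).1 := by
  obtain rfl : a = b := funext h
  simp [blockTensor_one]

theorem comp_assoc (f : Mor n m) (g : Mor m p) (h : Mor p q) :
    (f.comp g).comp h = f.comp (g.comp h) := by
  refine ext' (fun i j => (dot_compRank g h i (f.col j))) fun l a => ?_
  rw [comp_gauge, comp_gauge]
  have hX : compGaugeMat (f.comp g) h l a =
      castMat (dot_congr (r := h.rank l) (fun _ => rfl) fun k => dot_compRank f g k a)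
      * ((h.gauge l (g.app (f.app a))).1
      * (blockTensor (r := h.rank l) (r' := h.rank l) (a := g.app (f.app a))
          (a' := g.app (f.app a)) (fun _ => 1) (fun k => (g.gauge k (f.app a)).1)
      * (blockTensor (r := h.rank l) (r' := h.rank l) (a := g.app (f.app a))
          (a' := g.app (f.app a)) (fun _ => 1)
          (fun k => blockTensor (r := g.rank k) (r' := g.rank k) (fun _ => 1)
            (fun i => (f.gauge i a).1))
      * (permMat (blockPerm (r := h.rank l) (r' := h.rank l) (fun _ => Equiv.refl _)
          (fun k => exchange (g.rank k) f.rank a))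
      * (permMat (exchange (h.rank l) (f.compRank g) a)
      * (blockTensor (a := a) (a' := a) (fun j => blockTensor (r := h.rank l) (r' := h.rank l)
            (fun _ => 1) (fun k => ((g.gauge k (f.col j))⁻¹).1)) (fun _ => 1)
      * blockTensor (a := a) (a' := a)
          (fun j => ((h.gauge l (g.app (f.col j)))⁻¹).1) (fun _ => 1))))))) := by
    have e1 : (fun k => ((f.comp g).gauge k a).1) = fun k =>
        castMat (dot_compRank f g k a) * ((g.gauge k (f.app a)).1 *
          (blockTensor (r := g.rank k) (r' := g.rank k) (fun _ => 1)
            (fun i => (f.gauge i a).1) * (permMat (exchange (g.rank k) f.rank a) *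
          blockTensor (r := f.compRank g k) (r' := f.compRank g k) (a := a) (a' := a)
            (fun j => ((g.gauge k (f.col j))⁻¹).1) (fun _ => 1)))) := by
      funext k
      rw [comp_gauge, compGaugeMat]
      simp only [Matrix.mul_assoc]
    have e2 := blockTensor_exchange (r := h.rank l) (r' := h.rank l)
      (R := f.compRank g) (R' := f.compRank g) (a := a) (a' := a) (fun _ => 1)
      (fun k j => ((g.gauge k (f.col j))⁻¹).1) (fun _ => 1)
    have e3 := blockTensor_permMat (r := h.rank l) (r' := h.rank l) (fun _ => Equiv.refl _)
          (fun k => exchange (g.rank k) f.rank a)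
    simp only [permMat_refl] at e3
    have e4 : blockTensor (r := h.rank l) (r' := h.rank l) (fun _ => 1) (fun k =>
          castMat (dot_compRank f g k a) * ((g.gauge k (f.app a)).1 *
          (blockTensor (r := g.rank k) (r' := g.rank k) (fun _ => 1)
            (fun i => (f.gauge i a).1) * (permMat (exchange (g.rank k) f.rank a) *
          blockTensor (r := f.compRank g k) (r' := f.compRank g k) (a := a) (a' := a)
            (fun j => ((g.gauge k (f.col j))⁻¹).1) (fun _ => 1))))) =
        blockTensor (r := h.rank l) (r' := h.rank l) (fun _ => 1)
          (fun k => castMat (dot_compRank f g k a)) *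
        (blockTensor (r := h.rank l) (r' := h.rank l) (fun _ => 1)
          (fun k => (g.gauge k (f.app a)).1) *
        (blockTensor (r := h.rank l) (r' := h.rank l) (fun _ => 1)
          (fun k => blockTensor (r := g.rank k) (r' := g.rank k) (fun _ => 1)
            (fun i => (f.gauge i a).1)) *
        (blockTensor (r := h.rank l) (r' := h.rank l) (fun _ => 1)
          (fun k => permMat (exchange (g.rank k) f.rank a)) *
        blockTensor (r := h.rank l) (r' := h.rank l) (fun _ => 1)
          (fun k => blockTensor (r := f.compRank g k) (r' := f.compRank g k) (a := a) (a' := a)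
            (fun j => ((g.gauge k (f.col j))⁻¹).1) (fun _ => 1))))) := by
      simp only [blockTensor_mul, Matrix.one_mul]
    rw [compGaugeMat, e1, e4]
    simp only [Matrix.mul_assoc]
    rw [mul3_assoc _ _ (gauge_blockTensor_cast h l fun k => dot_compRank f g k a), e3,
      mul3_assoc _ _ e2]
    simp only [Matrix.mul_assoc]
  have hY : compGaugeMat f (g.comp h) l a =
      castMat (dot_compRank g h l (f.app a))
      * ((h.gauge l (g.app (f.app a))).1
      * (blockTensor (r := h.rank l) (r' := h.rank l) (a := g.app (f.app a))
          (a' := g.app (f.app a)) (fun _ => 1) (fun k => (g.gauge k (f.app a)).1)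
      * (blockTensor (r := h.rank l) (r' := h.rank l) (a := g.app (f.app a))
          (a' := g.app (f.app a)) (fun _ => 1)
          (fun k => blockTensor (r := g.rank k) (r' := g.rank k) (fun _ => 1)
            (fun i => (f.gauge i a).1))
      * (permMat (exchange (h.rank l) g.rank (f.app a))
      * (permMat (exchange (g.compRank h l) f.rank a)
      * (permMat (blockPerm (r := f.compRank (g.comp h) l) (a := a) (a' := a)
          (r' := fun j => dot (h.rank l) (g.app (f.col j)))
          (fun j => (exchange (h.rank l) g.rank (f.col j))) (fun _ => Equiv.refl _)).symm
      * (blockTensor (a := a) (a' := a) (fun j => blockTensor (r := h.rank l) (r' := h.rank l)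
            (fun _ => 1) (fun k => ((g.gauge k (f.col j))⁻¹).1)) (fun _ => 1)
      * (blockTensor (a := a) (a' := a)
          (fun j => ((h.gauge l (g.app (f.col j)))⁻¹).1) (fun _ => 1)
      * castMat (dot_congr (r := f.compRank (g.comp h) l) (a := a) (a' := a)
          (r' := fun j => dot (h.rank l) (g.app (f.col j)))
          (fun j => (dot_compRank g h l (f.col j)).symm) (fun _ => rfl)))))))))) := by
    have e1 : (fun j => (((g.comp h).gauge l (f.col j))⁻¹).1) = fun j =>
        blockTensor (r := g.compRank h l) (r' := g.compRank h l) (a := f.col j) (a' := f.col j)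
          (fun i => (h.gauge l (g.col i)).1) (fun _ => 1)
        * (permMat (exchange (h.rank l) g.rank (f.col j)).symm
        * (blockTensor (r := h.rank l) (r' := h.rank l) (a := g.app (f.col j))
          (a' := g.app (f.col j)) (fun _ => 1) (fun k => ((g.gauge k (f.col j))⁻¹).1)
        * (((h.gauge l (g.app (f.col j)))⁻¹).1
        * castMat (dot_compRank g h l (f.col j)).symm))) := by
      funext j
      rw [comp_gauge_inv, compGaugeInv]
      simp only [Matrix.mul_assoc]
    have e2 : blockTensor (r := f.compRank (g.comp h) l) (a := a) (a' := a) (fun j =>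
        blockTensor (r := g.compRank h l) (r' := g.compRank h l) (a := f.col j) (a' := f.col j)
          (fun i => (h.gauge l (g.col i)).1) (fun _ => 1)
        * (permMat (exchange (h.rank l) g.rank (f.col j)).symm
        * (blockTensor (r := h.rank l) (r' := h.rank l) (a := g.app (f.col j))
          (a' := g.app (f.col j)) (fun _ => 1) (fun k => ((g.gauge k (f.col j))⁻¹).1)
        * (((h.gauge l (g.app (f.col j)))⁻¹).1
        * castMat (dot_compRank g h l (f.col j)).symm)))) (fun _ => 1) =
        blockTensor (a := a) (a' := a) (fun j =>
          blockTensor (r := g.compRank h l) (r' := g.compRank h l) (a := f.col j) (a' := f.col j)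
          (fun i => (h.gauge l (g.col i)).1) (fun _ => 1)) (fun _ => 1)
        * (blockTensor (a := a) (a' := a) (fun j =>
          permMat (exchange (h.rank l) g.rank (f.col j)).symm) (fun _ => 1)
        * (blockTensor (a := a) (a' := a) (fun j =>
          blockTensor (r := h.rank l) (r' := h.rank l) (a := g.app (f.col j))
          (a' := g.app (f.col j)) (fun _ => 1) (fun k => ((g.gauge k (f.col j))⁻¹).1)) (fun _ => 1)
        * (blockTensor (a := a) (a' := a) (fun j => ((h.gauge l (g.app (f.col j)))⁻¹).1)
            (fun _ => 1)
        * blockTensor (a := a) (a' := a)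
            (fun j => castMat (dot_compRank g h l (f.col j)).symm) (fun _ => 1)))) := by
      simp only [blockTensor_mul, Matrix.one_mul]
    have e3 := blockTensor_castMat (a := a) (r := f.compRank (g.comp h) l)
      (r' := fun j => dot (h.rank l) (g.app (f.col j)))
      (fun j => (dot_compRank g h l (f.col j)).symm) (fun _ => rfl)
    simp only [castMat_rfl] at e3
    have e4 := blockTensor_permMat (a := a) (r' := f.compRank (g.comp h) l)
      (r := fun j => dot (h.rank l) (g.app (f.col j)))
      (fun j => (exchange (h.rank l) g.rank (f.col j)).symm) (fun _ => Equiv.refl _)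
    simp only [permMat_refl] at e4
    have e5 := blockTensor_exchange (r := g.compRank h l) (r' := g.compRank h l)
      (R := f.rank) (R' := f.rank) (a := a) (a' := a)
      (fun i => ((h.gauge l (g.col i))⁻¹).1) (fun _ _ => 1) (fun _ => 1)
    simp only [blockTensor_one] at e5
    have e6 := blockTensor_exchange (r := h.rank l) (r' := h.rank l)
      (R := g.rank) (R' := g.rank) (a := f.app a) (a' := f.app a)
      (fun _ => 1) (fun _ _ => 1) (fun i => (f.gauge i a).1)
    simp only [blockTensor_one] at e6
    have e7 : blockTensor (r := g.compRank h l) (r' := g.compRank h l) (a := f.app a)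
        (a' := f.app a) (fun i => ((h.gauge l (g.col i))⁻¹).1) (fun _ => 1) *
        blockTensor (r := g.compRank h l) (r' := g.compRank h l) (a := f.app a)
        (a' := f.app a) (fun _ => 1) (fun i => (f.gauge i a).1) =
        blockTensor (r := g.compRank h l) (r' := g.compRank h l) (a := f.app a)
        (a' := f.app a) (fun _ => 1) (fun i => (f.gauge i a).1) *
        blockTensor (r := g.compRank h l) (r' := g.compRank h l) (a := f.app a)
        (a' := f.app a) (fun i => ((h.gauge l (g.col i))⁻¹).1) (fun _ => 1) := by
      simp only [blockTensor_mul, Matrix.one_mul, Matrix.mul_one]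
    have e8 : blockTensor (a := a) (a' := a) (fun j =>
          blockTensor (r := g.compRank h l) (r' := g.compRank h l) (a := f.col j) (a' := f.col j)
          (fun i => ((h.gauge l (g.col i))⁻¹).1) (fun _ => 1)) (fun _ => 1) *
        blockTensor (a := a) (a' := a) (fun j =>
          blockTensor (r := g.compRank h l) (r' := g.compRank h l) (a := f.col j) (a' := f.col j)
          (fun i => (h.gauge l (g.col i)).1) (fun _ => 1)) (fun _ => 1) = 1 := by
      simp only [blockTensor_mul, Matrix.one_mul, gauge_inv_mul, blockTensor_one]
    rw [compGaugeMat, e1, e2, e3, e4, comp_gauge, compGaugeMat]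
    simp only [Matrix.mul_assoc]
    rw [mul3_assoc _ _ e7]
    simp only [Matrix.mul_assoc]
    rw [mul3_assoc _ _ e5]
    simp only [Matrix.mul_assoc]
    rw [mul3_assoc _ _ e8, Matrix.one_mul, mul3_assoc _ _ e6.symm]
    simp only [Matrix.mul_assoc]
    rfl
  have hP : permMat (exchange (h.rank l) g.rank (f.app a)) *
      permMat (exchange (g.compRank h l) f.rank a) =
      permMat (blockPerm (r := h.rank l) (r' := h.rank l) (fun _ => Equiv.refl _)
          (fun k => exchange (g.rank k) f.rank a)) *
      (permMat (exchange (h.rank l) (f.compRank g) a) *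
      permMat (blockPerm (a := a) (a' := a)
          (fun j => (exchange (h.rank l) g.rank (f.col j))) (fun _ => Equiv.refl _))) := by
    rw [permMat_mul_permMat, permMat_mul_permMat, permMat_mul_permMat]
    congr 1
    exact Equiv.ext fun p => exchange_pentagon _ _ _ _ p
  rw [hX, hY]
  simp only [Matrix.mul_assoc]
  rw [mul3_assoc _ _ hP]
  simp only [Matrix.mul_assoc]
  rw [mul3_assoc _ _ (permMat_mul_symm _), Matrix.one_mul]
  rw [mul3_assoc _ _ (castMat_mul _ _), mul3_assoc _ _ (castMat_mul _ _),
    mul3_assoc _ _ (castMat_mul _ _)]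

end Mor

namespace Mor
variable {n m p q : ℕ}

/-- 2-morphisms `f ⇒ g` of `2Mat`: matrices of matrices, the `(i, j)` entry being of size
`g.rank i j × f.rank i j`. -/
@[ext] structure Hom2 (f g : Mor n m) where
  entry : ∀ i j, Matrix (Fin (g.rank i j)) (Fin (f.rank i j)) ℂ

/-- Vertical composition is the entrywise product of matrices. -/
instance : Category (Mor n m) where
  Hom := Hom2
  id _ := ⟨fun _ _ => 1⟩
  comp T T' := ⟨fun i j => T'.entry i j * T.entry i j⟩
  id_comp T := Hom2.ext (by funext i j; exact Matrix.mul_one _)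
  comp_id T := Hom2.ext (by funext i j; exact Matrix.one_mul _)
  assoc T T' T'' := Hom2.ext (by funext i j; exact (Matrix.mul_assoc _ _ _).symm)

theorem id_entry (f : Mor n m) (i j) : Hom2.entry (𝟙 f) i j = 1 := rfl

theorem comp_entry {f g h : Mor n m} (T : f ⟶ g) (T' : g ⟶ h) (i j) :
    (T ≫ T').entry i j = T'.entry i j * T.entry i j := rfl

theorem eqToHom_entry {f g : Mor n m} (h : f = g) (i j) :
    Hom2.entry (eqToHom h) i j = castMat (by rw [h]) := by
  subst h; rfl

theorem hom_ext {f g : Mor n m} {T T' : f ⟶ g} (h : ∀ i j, T.entry i j = T'.entry i j) :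
    T = T' := Hom2.ext (by funext i j; exact h i j)

/-- Horizontal composition of 2-morphisms, with entries
`t'_k(R'(e_j)) (⨁ i, U_ki ⊗ T_ij) t_k(R(e_j))⁻¹`. -/
def hcomp {f f' : Mor n m} {g g' : Mor m p} (T : f ⟶ f') (U : g ⟶ g') :
    f.comp g ⟶ f'.comp g' :=
  Hom2.mk fun k j =>
    ((g'.gauge k (f'.col j)).1 *
      blockTensor (r := g.rank k) (r' := g'.rank k) (a := f.col j) (a' := f'.col j)
        (U.entry k) (fun i => T.entry i j) *
      ((g.gauge k (f.col j))⁻¹).1 :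
      Matrix (Fin (dot (g'.rank k) (f'.col j))) (Fin (dot (g.rank k) (f.col j))) ℂ)

theorem hcomp_entry {f f' : Mor n m} {g g' : Mor m p} (T : f ⟶ f') (U : g ⟶ g') (k j) :
    (hcomp T U).entry k j = (g'.gauge k (f'.col j)).1 *
      (blockTensor (r := g.rank k) (r' := g'.rank k) (a := f.col j) (a' := f'.col j)
        (U.entry k) (fun i => T.entry i j) *
      ((g.gauge k (f.col j))⁻¹).1) := Matrix.mul_assoc _ _ _

theorem hcomp_id (f : Mor n m) (g : Mor m p) : hcomp (𝟙 f) (𝟙 g) = 𝟙 (f.comp g) := by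
  refine hom_ext fun k j => ?_
  rw [hcomp_entry, id_entry]
  have : blockTensor (r := g.rank k) (r' := g.rank k) (a := f.col j) (a' := f.col j)
        (Hom2.entry (𝟙 g) k) (fun i => Hom2.entry (𝟙 f) i j) = 1 := blockTensor_one _ _
  rw [this, Matrix.one_mul, gauge_mul_inv]

theorem hcomp_comp {f f' f'' : Mor n m} {g g' g'' : Mor m p} (T : f ⟶ f') (T' : f' ⟶ f'')
    (U : g ⟶ g') (U' : g' ⟶ g'') : hcomp (T ≫ T') (U ≫ U') = hcomp T U ≫ hcomp T' U' := by
  refine hom_ext fun k j => ?_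
  rw [comp_entry, hcomp_entry, hcomp_entry, hcomp_entry]
  simp only [Matrix.mul_assoc]
  rw [mul3_assoc _ _ (gauge_inv_mul _ _ _), Matrix.one_mul,
    mul3_assoc _ _ (blockTensor_mul _ _ _ _)]
  rfl

theorem compGauge_key {f f' : Mor n m} {g g' : Mor m p} (T : f ⟶ f') (U : g ⟶ g') (l : Fin p)
    {a a' : Fin n → ℕ} (B : ∀ j, Matrix (Fin (a' j)) (Fin (a j)) ℂ) :
    compGaugeMat f' g' l a' * (blockTensor (r := f.compRank g l) (r' := f'.compRank g' l)
      ((hcomp T U).entry l) B * compGaugeInv f g l a) =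
    (g'.gauge l (f'.app a')).1 *
      (blockTensor (r := g.rank l) (r' := g'.rank l) (a := f.app a) (a' := f'.app a') (U.entry l)
        (fun k => (f'.gauge k a').1 * (blockTensor (r := f.rank k) (r' := f'.rank k)
          (T.entry k) B * ((f.gauge k a)⁻¹).1)) *
      ((g.gauge l (f.app a))⁻¹).1) := by
  have e1 : blockTensor (r := f.compRank g l) (r' := f'.compRank g' l) ((hcomp T U).entry l) B =
      blockTensor (r := f'.compRank g' l) (r' := f'.compRank g' l) (a := a') (a' := a')
        (fun j => (g'.gauge l (f'.col j)).1) (fun _ => 1) *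
      (blockTensor (r := f.compRank g l) (r' := f'.compRank g' l)
        (fun j => blockTensor (r := g.rank l) (r' := g'.rank l) (a := f.col j) (a' := f'.col j)
        (U.entry l) (fun i => T.entry i j)) B *
      blockTensor (r := f.compRank g l) (r' := f.compRank g l) (a := a) (a' := a)
        (fun j => ((g.gauge l (f.col j))⁻¹).1) (fun _ => 1)) := by
    rw [blockTensor_mul, blockTensor_mul]
    simp only [Matrix.one_mul, Matrix.mul_one, ← hcomp_entry]
  have e2 : blockTensor (r := g.rank l) (r' := g'.rank l) (a := f.app a) (a' := f'.app a')
        (U.entry l)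
        (fun k => (f'.gauge k a').1 * (blockTensor (r := f.rank k) (r' := f'.rank k)
          (T.entry k) B * ((f.gauge k a)⁻¹).1)) =
      blockTensor (r := g'.rank l) (r' := g'.rank l) (a := f'.app a') (a' := f'.app a')
        (fun _ => 1) (fun k => (f'.gauge k a').1) *
      (blockTensor (r := g.rank l) (r' := g'.rank l) (a := f.app a) (a' := f'.app a')
        (U.entry l) (fun k => blockTensor (r := f.rank k) (r' := f'.rank k) (T.entry k) B) *
      blockTensor (r := g.rank l) (r' := g.rank l) (a := f.app a) (a' := f.app a)
        (fun _ => 1) (fun k => ((f.gauge k a)⁻¹).1)) := by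
    rw [blockTensor_mul, blockTensor_mul]
    simp only [Matrix.one_mul, Matrix.mul_one]
  have e3 := blockTensor_exchange (U.entry l) T.entry B
  rw [e1, e2, compGaugeMat, compGaugeInv]
  simp only [Matrix.mul_assoc]
  have e4 : blockTensor (r := f'.compRank g' l) (r' := f'.compRank g' l) (a := a') (a' := a')
        (fun j => ((g'.gauge l (f'.col j))⁻¹).1) (fun _ => 1) *
      blockTensor (r := f'.compRank g' l) (r' := f'.compRank g' l) (a := a') (a' := a')
        (fun j => (g'.gauge l (f'.col j)).1) (fun _ => 1) = 1 := by
    simp only [blockTensor_mul, gauge_inv_mul, Matrix.one_mul, blockTensor_one]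
  have e5 : blockTensor (r := f.compRank g l) (r' := f.compRank g l) (a := a) (a' := a)
        (fun j => ((g.gauge l (f.col j))⁻¹).1) (fun _ => 1) *
      blockTensor (r := f.compRank g l) (r' := f.compRank g l) (a := a) (a' := a)
        (fun j => (g.gauge l (f.col j)).1) (fun _ => 1) = 1 := by
    simp only [blockTensor_mul, gauge_inv_mul, Matrix.one_mul, blockTensor_one]
  rw [mul3_assoc _ _ e4, Matrix.one_mul, mul3_assoc _ _ e5, Matrix.one_mul,
    mul3_assoc _ _ e3.symm]
  simp only [Matrix.mul_assoc]
  rw [mul3_assoc _ _ (permMat_mul_symm _), Matrix.one_mul]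

theorem hcomp_assoc {f f' : Mor n m} {g g' : Mor m p} {h h' : Mor p q} (T : f ⟶ f')
    (U : g ⟶ g') (V : h ⟶ h') :
    hcomp (hcomp T U) V ≫ eqToHom (comp_assoc f' g' h') =
      eqToHom (comp_assoc f g h) ≫ hcomp T (hcomp U V) := by
  refine hom_ext fun l j => ?_
  rw [comp_entry, comp_entry, eqToHom_entry, eqToHom_entry, hcomp_entry, hcomp_entry,
    comp_gauge, comp_gauge_inv]
  have := compGauge_key U V l (a := f.col j) (a' := f'.col j) (fun i => T.entry i j)
  simp only [Matrix.mul_assoc] at this ⊢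
  rw [castMat_mul, castMat_rfl, Matrix.mul_one]
  have e : blockTensor (V.entry l) (fun i => (hcomp T U).entry i j) = _ :=
    congrArg (blockTensor (r := h.rank l) (r' := h'.rank l) (a := g.app (f.col j))
      (a' := g'.app (f'.col j)) (V.entry l)) (funext fun i => hcomp_entry T U i j)
  change castMat _ * ((h'.gauge l (g'.app (f'.col j))).1 *
    (blockTensor (r := h.rank l) (r' := h'.rank l) (a := g.app (f.col j))
      (a' := g'.app (f'.col j)) (V.entry l) (fun i => (hcomp T U).entry i j) *
    ((h.gauge l (g.app (f.col j)))⁻¹).1)) = _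
  rw [e, ← this]

end Mor

namespace Mor
variable {n m p q : ℕ}

theorem hcomp_idL {f g : Mor n m} (T : f ⟶ g) :
    hcomp (𝟙 (id n)) T ≫ eqToHom (id_comp g) = eqToHom (id_comp f) ≫ T := by
  refine hom_ext fun i j => ?_
  rw [comp_entry, comp_entry, eqToHom_entry, eqToHom_entry, hcomp_entry]
  have h1 : ((g.gauge i ((id n).col j))).1 = 1 :=
    congrArg Units.val (g.gauge_stdVec i j)
  have h2 : ((f.gauge i ((id n).col j))⁻¹).1 = 1 := by
    rw [show f.gauge i ((id n).col j) = 1 from f.gauge_stdVec i j]; simp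
  have h3 := blockTensor_stdVec (r := f.rank i) (r' := g.rank i) j (T.entry i)
  have h4 : blockTensor (r := f.rank i) (r' := g.rank i) (a := (id n).col j)
    (a' := (id n).col j) (T.entry i) (fun k => Hom2.entry (𝟙 (id n)) k j) = _ := h3
  rw [h1, h2, h4, Matrix.one_mul, Matrix.mul_one]
  simp only [Matrix.mul_assoc]
  rw [mul3_assoc _ _ (castMat_mul _ _), castMat_rfl, Matrix.one_mul]

theorem hcomp_idR {f g : Mor n m} (T : f ⟶ g) :
    hcomp T (𝟙 (id m)) ≫ eqToHom (comp_id g) = eqToHom (comp_id f) ≫ T := by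
  refine hom_ext fun i j => ?_
  rw [comp_entry, comp_entry, eqToHom_entry, eqToHom_entry, hcomp_entry]
  have h1 : ((id m).gauge i (g.col j)).1 = 1 := rfl
  have h2 : (((id m).gauge i (f.col j))⁻¹).1 = 1 := by
    rw [show (id m).gauge i (f.col j) = 1 from rfl]; simp
  have h3 := blockTensor_stdRow (a := f.col j) (a' := g.col j) i (fun k => T.entry k j)
  have h4 : blockTensor (r := (id m).rank i) (r' := (id m).rank i) (a := f.col j)
    (a' := g.col j) (Hom2.entry (𝟙 (id m)) i) (fun k => T.entry k j) = _ := h3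
  rw [h1, h2, h4, Matrix.one_mul, Matrix.mul_one]
  simp only [Matrix.mul_assoc]
  rw [mul3_assoc _ _ (castMat_mul _ _), castMat_rfl, Matrix.one_mul]

theorem hcomp_eqToHom {f f' : Mor n m} {g g' : Mor m p} (h : f = f') (h' : g = g') :
    hcomp (eqToHom h) (eqToHom h') = eqToHom (by rw [h, h']) := by
  subst h; subst h'; exact hcomp_id f g

end Mor

/-- Objects of `2Mat`: natural numbers. -/
structure TwoMat where
  dim : ℕ

namespace TwoMat
open Mor

instance : CategoryStruct TwoMat where
  Hom X Y := Mor X.dim Y.dim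
  id X := Mor.id X.dim
  comp f g := Mor.comp f g

instance homCat (X Y : TwoMat) : Category (X ⟶ Y) := inferInstanceAs (Category (Mor _ _))

/-- The 2-category `2Mat`. Composition of 1-morphisms is strictly associative and unital, and the
associator and unitors are the identities. -/
instance : Bicategory TwoMat where
  whiskerLeft f _ _ T := hcomp (𝟙 f) T
  whiskerRight T h := hcomp T (𝟙 h)
  associator f g h := eqToIso (Mor.comp_assoc f g h)
  leftUnitor f := eqToIso (Mor.id_comp f)
  rightUnitor f := eqToIso (Mor.comp_id f)
  whiskerLeft_id f g := hcomp_id f g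
  whiskerLeft_comp f _ _ _ T U := by
    rw [← hcomp_comp, Category.comp_id]
  id_whiskerLeft {a b f g} T :=
    ((comp_eqToHom_iff _ _ _).1 (hcomp_idL T)).trans (Category.assoc _ _ _)
  comp_whiskerLeft f g _ _ T := by
    have h := (comp_eqToHom_iff _ _ _).1 (hcomp_assoc (𝟙 f) (𝟙 g) T)
    rw [hcomp_id] at h
    exact h.trans (Category.assoc _ _ _)
  id_whiskerRight f g := hcomp_id f g
  comp_whiskerRight T U h := by
    rw [← hcomp_comp, Category.comp_id]
  whiskerRight_id T :=
    ((comp_eqToHom_iff _ _ _).1 (hcomp_idR T)).trans (Category.assoc _ _ _)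
  whiskerRight_comp T g h := by
    have h := (eqToHom_comp_iff _ _ _).1 (hcomp_assoc T (𝟙 g) (𝟙 h)).symm
    rw [hcomp_id] at h
    exact h
  whisker_assoc f _ _ T h := by
    have h := (comp_eqToHom_iff _ _ _).1 (hcomp_assoc (𝟙 f) T (𝟙 h))
    exact h.trans (Category.assoc _ _ _)
  whisker_exchange T U := by
    rw [← hcomp_comp, ← hcomp_comp]; simp only [Category.comp_id, Category.id_comp]
  pentagon f g h i := by
    simp only [eqToIso.hom]
    have e1 := hcomp_eqToHom (Mor.comp_assoc f g h) (rfl : i = i)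
    have e2 := hcomp_eqToHom (rfl : f = f) (Mor.comp_assoc g h i)
    rw [eqToHom_refl] at e1 e2
    erw [e1, e2]
    simp only [eqToHom_trans]
  triangle f g := by
    have e1 := hcomp_eqToHom (Mor.comp_id f) (rfl : g = g)
    have e2 := hcomp_eqToHom (rfl : f = f) (Mor.id_comp g)
    rw [eqToHom_refl] at e1 e2
    simp only [eqToIso.hom]
    erw [e1, e2]
    simp only [eqToHom_trans]

instance : Bicategory.Strict TwoMat where
  id_comp := Mor.id_comp
  comp_id := Mor.comp_id
  assoc := Mor.comp_assoc

end TwoMat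

/-! ### Special 2-groups -/

/-- A monoidal category is a special 2-group if it is a skeletal groupoid, the unit object is a
strict unit (the unitors are identities) and every object is strictly invertible. -/
class SpecialTwoGroup (𝔾 : Type u) [Category.{v} 𝔾] [MonoidalCategory 𝔾] : Prop where
  isIso : ∀ {A B : 𝔾} (f : A ⟶ B), IsIso f
  skeletal : ∀ {A B : 𝔾}, Nonempty (A ≅ B) → A = B
  unit_tensor : ∀ A : 𝔾, 𝟙_ 𝔾 ⊗ A = A
  tensor_unit : ∀ A : 𝔾, A ⊗ 𝟙_ 𝔾 = A
  leftUnitor_eq : ∀ A : 𝔾, (λ_ A).hom = eqToHom (unit_tensor A)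
  rightUnitor_eq : ∀ A : 𝔾, (ρ_ A).hom = eqToHom (tensor_unit A)
  exists_inv : ∀ A : 𝔾, ∃ B : 𝔾, A ⊗ B = 𝟙_ 𝔾 ∧ B ⊗ A = 𝟙_ 𝔾

namespace SpecialTwoGroup
variable {𝔾 : Type u} [Category.{v} 𝔾] [MonoidalCategory 𝔾]

/-- The map `γ_A : Aut I → Aut A`, `x ↦ l_A ∘ (x ⊗ id_A) ∘ l_A⁻¹`. -/
def gammaHom (A : 𝔾) (x : Aut (𝟙_ 𝔾)) : A ⟶ A := (λ_ A).inv ≫ x.hom ▷ A ≫ (λ_ A).hom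

/-- The map `δ_A : Aut I → Aut A`, `x ↦ r_A ∘ (id_A ⊗ x) ∘ r_A⁻¹`. -/
def deltaHom (A : 𝔾) (x : Aut (𝟙_ 𝔾)) : A ⟶ A := (ρ_ A).inv ≫ A ◁ x.hom ≫ (ρ_ A).hom

theorem gammaHom_mul (A : 𝔾) (x y : Aut (𝟙_ 𝔾)) :
    gammaHom A (x * y) = gammaHom A y ≫ gammaHom A x := by
  have h : (x * y).hom = y.hom ≫ x.hom := rfl
  simp [gammaHom, h]

theorem gammaHom_one (A : 𝔾) : gammaHom A 1 = 𝟙 A := by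
  have h : (1 : Aut (𝟙_ 𝔾)).hom = 𝟙 _ := rfl
  simp [gammaHom, h]

theorem gammaHom_tensor (A B : 𝔾) (x) : gammaHom (A ⊗ B) x = gammaHom A x ▷ B := by
  simp [gammaHom]

theorem deltaHom_whiskerRight (A B : 𝔾) (x) : deltaHom A x ▷ B = A ◁ gammaHom B x := by
  simp only [deltaHom, gammaHom, comp_whiskerRight, MonoidalCategory.whiskerLeft_comp, whisker_assoc]
  simp

variable [SpecialTwoGroup 𝔾]

theorem eq_of_hom {A B : 𝔾} (f : A ⟶ B) : A = B :=
  haveI := isIso f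
  skeletal ⟨asIso f⟩

theorem tensor_assoc (A B C : 𝔾) : (A ⊗ B) ⊗ C = A ⊗ (B ⊗ C) := eq_of_hom (α_ A B C).hom

/-- `- ⊗ A` is inverse to `- ⊗ B` when `A ⊗ B = I`. -/
def tensorRightIso {A B : 𝔾} (h : A ⊗ B = 𝟙_ 𝔾) :
    tensorRight A ⋙ tensorRight B ≅ 𝟭 𝔾 :=
  NatIso.ofComponents (fun X => α_ X A B ≪≫ whiskerLeftIso X (eqToIso h) ≪≫ ρ_ X)
    (by
      intro X Y f
      change f ▷ A ▷ B ≫ (α_ Y A B).hom ≫ Y ◁ (eqToHom h) ≫ (ρ_ Y).hom =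
        ((α_ X A B).hom ≫ X ◁ eqToHom h ≫ (ρ_ X).hom) ≫ f
      rw [associator_naturality_left_assoc, ← whisker_exchange_assoc, rightUnitor_naturality]
      simp only [Category.assoc])

instance (A : 𝔾) : (tensorRight A).Faithful := by
  obtain ⟨B, h, -⟩ := exists_inv A
  exact Functor.Faithful.of_comp_iso (tensorRightIso h)

instance (A : 𝔾) : (tensorRight A).Full := by
  obtain ⟨B, h, -⟩ := exists_inv A
  exact Functor.Full.of_comp_faithful_iso (tensorRightIso h)

theorem gammaHom_bijective (A : 𝔾) : Function.Bijective (gammaHom A) := by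
  constructor
  · intro x y h
    ext
    apply (tensorRight A).map_injective
    simpa [gammaHom] using h
  · intro f
    obtain ⟨x, hx⟩ := (tensorRight A).map_surjective ((λ_ A).hom ≫ f ≫ (λ_ A).inv)
    have := isIso x
    refine ⟨asIso x, ?_⟩
    have hx' : x ▷ A = _ := hx
    simp [gammaHom, hx']

/-- The inverse of the bijection `γ_A : Aut I → Aut A = (A ⟶ A)`. -/
noncomputable def gammaInv (A : 𝔾) (f : A ⟶ A) : Aut (𝟙_ 𝔾) :=
  (Equiv.ofBijective _ (gammaHom_bijective A)).symm f

theorem gammaHom_gammaInv (A : 𝔾) (f : A ⟶ A) : gammaHom A (gammaInv A f) = f :=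
  (Equiv.ofBijective _ (gammaHom_bijective A)).apply_symm_apply f

theorem gammaInv_eq {A : 𝔾} {f : A ⟶ A} {x} (h : f = gammaHom A x) : gammaInv A f = x :=
  (gammaHom_bijective A).1 ((gammaHom_gammaInv A f).trans h)

/-- The action of `π₀` on `π₁ = Aut I`, `A · x = γ_A⁻¹ (δ_A x)`. -/
noncomputable def act (A : 𝔾) (x : Aut (𝟙_ 𝔾)) : Aut (𝟙_ 𝔾) := gammaInv A (deltaHom A x)

/-- The element `γ_A⁻¹ f` of `π₁` attached to a morphism `f : A ⟶ B` (for which `A = B`, the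
2-group being skeletal). For `f` the associator of `g₁, g₂, g₃` this is the classifying
3-cocycle `α(g₁, g₂, g₃)`. -/
noncomputable def cls {A B : 𝔾} (f : A ⟶ B) : Aut (𝟙_ 𝔾) :=
  gammaInv A (f ≫ eqToHom (eq_of_hom f).symm)

theorem cls_eq {A : 𝔾} (f : A ⟶ A) : cls f = gammaInv A f := by simp [cls]

theorem cls_id (A : 𝔾) : cls (𝟙 A) = 1 := by
  rw [cls_eq]; exact gammaInv_eq (gammaHom_one A).symm

theorem cls_eqToHom {A B : 𝔾} (h : A = B) : cls (eqToHom h) = 1 := by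
  subst h; exact cls_id A

theorem cls_comp {A B C : 𝔾} (f : A ⟶ B) (g : B ⟶ C) : cls (f ≫ g) = cls g * cls f := by
  obtain rfl := eq_of_hom f
  obtain rfl := eq_of_hom g
  rw [cls_eq, cls_eq, cls_eq]
  exact gammaInv_eq (by rw [gammaHom_mul, gammaHom_gammaInv, gammaHom_gammaInv])

theorem cls_inv {A B : 𝔾} (e : A ≅ B) : cls e.inv = (cls e.hom)⁻¹ := by
  rw [eq_inv_iff_mul_eq_one, ← cls_comp, e.hom_inv_id, cls_id]

theorem cls_whiskerRight {A B : 𝔾} (f : A ⟶ B) (C : 𝔾) : cls (f ▷ C) = cls f := by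
  obtain rfl := eq_of_hom f
  rw [cls_eq, cls_eq]
  exact gammaInv_eq (by rw [gammaHom_tensor, gammaHom_gammaInv])

theorem cls_whiskerLeft (C : 𝔾) {A B : 𝔾} (f : A ⟶ B) : cls (C ◁ f) = act C (cls f) := by
  obtain rfl := eq_of_hom f
  rw [cls_eq, cls_eq]
  refine gammaInv_eq ?_
  rw [gammaHom_tensor, act, gammaHom_gammaInv, deltaHom_whiskerRight, gammaHom_gammaInv]

theorem cls_leftUnitor (A : 𝔾) : cls (λ_ A).hom = 1 := by
  rw [leftUnitor_eq, cls_eqToHom]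

theorem cls_rightUnitor (A : 𝔾) : cls (ρ_ A).hom = 1 := by
  rw [rightUnitor_eq, cls_eqToHom]

end SpecialTwoGroup

open SpecialTwoGroup

/-- `π₀` of a special 2-group: the set of objects, a group under the tensor product. -/
def PiZero (𝔾 : Type u) : Type u := 𝔾

noncomputable instance (𝔾 : Type u) [Category.{v} 𝔾] [MonoidalCategory 𝔾] [SpecialTwoGroup 𝔾] :
    Group (PiZero 𝔾) where
  mul A B := (A ⊗ B : 𝔾)
  one := 𝟙_ 𝔾
  mul_assoc A B C := tensor_assoc (𝔾 := 𝔾) A B C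
  one_mul A := unit_tensor (𝔾 := 𝔾) A
  mul_one A := tensor_unit (𝔾 := 𝔾) A
  inv A := (exists_inv (𝔾 := 𝔾) A).choose
  inv_mul_cancel A := (exists_inv (𝔾 := 𝔾) A).choose_spec.2

/-- The one-object bicategory of a monoidal category: its 1-morphisms are the objects, and the
composite `g ∘ f` is `g ⊗ f`. -/
structure Deloop (𝔾 : Type u) : Type where

namespace Deloop
variable {𝔾 : Type u} [Category.{v} 𝔾] [MonoidalCategory 𝔾]

instance : CategoryStruct (Deloop 𝔾) where
  Hom _ _ := 𝔾
  id _ := 𝟙_ 𝔾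
  comp f g := (g ⊗ f : 𝔾)

instance homCat (X Y : Deloop 𝔾) : Category (X ⟶ Y) := inferInstanceAs (Category 𝔾)

instance : Bicategory (Deloop 𝔾) where
  whiskerLeft f _ _ η := MonoidalCategory.whiskerRight (C := 𝔾) η f
  whiskerRight η h := MonoidalCategory.whiskerLeft (C := 𝔾) h η
  associator f g h := (MonoidalCategory.associator (C := 𝔾) h g f).symm
  leftUnitor f := MonoidalCategory.rightUnitor (C := 𝔾) f
  rightUnitor f := MonoidalCategory.leftUnitor (C := 𝔾) f
  whiskerLeft_id _ _ := MonoidalCategory.id_whiskerRight (C := 𝔾) _ _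
  whiskerLeft_comp _ _ _ _ _ _ := MonoidalCategory.comp_whiskerRight (C := 𝔾) _ _ _
  id_whiskerLeft _ := MonoidalCategory.whiskerRight_id (C := 𝔾) _
  comp_whiskerLeft _ _ _ _ _ := MonoidalCategory.whiskerRight_tensor (C := 𝔾) _ _ _
  id_whiskerRight _ _ := MonoidalCategory.whiskerLeft_id (C := 𝔾) _ _
  comp_whiskerRight _ _ _ := MonoidalCategory.whiskerLeft_comp (C := 𝔾) _ _ _
  whiskerRight_id _ := MonoidalCategory.id_whiskerLeft (C := 𝔾) _
  whiskerRight_comp _ _ _ := MonoidalCategory.tensor_whiskerLeft (C := 𝔾) _ _ _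
  whisker_assoc _ _ _ _ _ := MonoidalCategory.whisker_assoc_symm (C := 𝔾) _ _ _
  whisker_exchange _ _ := (MonoidalCategory.whisker_exchange (C := 𝔾) _ _).symm
  pentagon _ _ _ _ := MonoidalCategory.pentagon_inv (C := 𝔾)
  triangle _ _ := MonoidalCategory.triangle_assoc_comp_right (C := 𝔾) _ _

end Deloop

namespace Mor
variable {n m p q : ℕ}

/-- For equal 1-morphisms `f = g`, the 2-morphism whose entries are `x i` times the identity. -/
def scale {f g : Mor n m} (h : f = g) (x : Fin m → ℂˣ) : f ⟶ g :=
  Hom2.mk fun i j => ((x i : ℂˣ) : ℂ) •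
    (castMat (by rw [h]) : Matrix (Fin (g.rank i j)) (Fin (f.rank i j)) ℂ)

theorem blockTensor_smul_left {r r' a a' : Fin n → ℕ} (x : ℂ)
    (A : ∀ j, Matrix (Fin (r' j)) (Fin (r j)) ℂ) (B : ∀ j, Matrix (Fin (a' j)) (Fin (a j)) ℂ) :
    blockTensor (fun j => x • A j) B = x • blockTensor A B := by
  simp only [blockTensor, Matrix.smul_kronecker]
  rw [← Pi.smul_def, Matrix.blockDiagonal'_smul]
  rfl

theorem blockTensor_row {r a : Fin n → ℕ} {k : Fin n} (h : r = stdRow k) (x : Fin n → ℂ) :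
    blockTensor (r := r) (r' := r) (a := a) (a' := a) (fun _ => 1) (fun i => x i • 1) =
      x k • 1 := by
  subst h
  rw [blockTensor_stdRow]
  simp

theorem exchange_row {r : Fin m → ℕ} {k : Fin m} (h : r = stdRow k) (R : Fin m → Fin n → ℕ)
    (a : Fin n → ℕ) (h') : exchange r R a = finCongr h' := by
  subst h
  exact exchange_stdRow k R a h'

theorem scale_comp {f g h : Mor n m} (e : f = g) (e' : g = h) (x y : Fin m → ℂˣ) :
    scale e x ≫ scale e' y = scale (e.trans e') (x * y) := by
  subst e; subst e'
  refine hom_ext fun i j => ?_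
  rw [comp_entry]
  simp [scale, smul_smul]

theorem scale_one {f g : Mor n m} (e : f = g) : scale e 1 = eqToHom e := by
  subst e
  refine hom_ext fun i j => ?_
  rw [eqToHom_entry]
  simp [scale]

theorem hcomp_scaleR {f f' : Mor n m} {g g' : Mor m p} (e : f = f') (e' : g = g')
    (x : Fin p → ℂˣ) :
    hcomp (eqToHom e) (scale e' x) = scale (by rw [e, e']) x := by
  subst e; subst e'
  refine hom_ext fun k j => ?_
  rw [hcomp_entry]
  have : blockTensor (r := g.rank k) (r' := g.rank k) (a := f.col j) (a' := f.col j)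
      ((scale rfl x : g ⟶ g).entry k) (fun i => Hom2.entry (eqToHom (rfl : f = f)) i j) =
      ((x k : ℂˣ) : ℂ) • (1 : Matrix _ _ ℂ) := by
    rw [← blockTensor_one]
    exact blockTensor_smul_left _ _ _
  rw [this, Matrix.smul_mul, Matrix.mul_smul, Matrix.one_mul, gauge_mul_inv]
  simp [scale]

/-- The gauge trivial 1-morphism with rank matrix the permutation matrix `P(σ)`,
`P(σ)_ij = δ_{i, σ j}`. -/
abbrev perm (σ : Equiv.Perm (Fin n)) : Mor n n := ofRank fun i j => if i = σ j then 1 else 0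

theorem perm_rank (σ : Equiv.Perm (Fin n)) (i : Fin n) : (perm σ).rank i = stdRow (σ⁻¹ i) := by
  funext j
  simp only [stdRow, Equiv.Perm.inv_eq_iff_eq]

theorem hcomp_scaleL {f f' : Mor n m} {σ : Equiv.Perm (Fin m)} {g' : Mor m m} (e : f = f')
    (e' : perm σ = g') (x : Fin m → ℂˣ) :
    hcomp (scale e x) (eqToHom e') = scale (by rw [e, e']) (fun i => x (σ⁻¹ i)) := by
  subst e; subst e'
  refine hom_ext fun k j => ?_
  rw [hcomp_entry]
  have : blockTensor (r := (perm σ).rank k) (r' := (perm σ).rank k) (a := f.col j) (a' := f.col j)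
      (Hom2.entry (eqToHom (rfl : perm σ = perm σ)) k) (fun i => (scale rfl x : f ⟶ f).entry i j) =
      ((x (σ⁻¹ k) : ℂˣ) : ℂ) • (1 : Matrix _ _ ℂ) := by
    exact blockTensor_row (perm_rank σ k) (fun i => ((x i : ℂˣ) : ℂ))
  rw [this, Matrix.smul_mul, Matrix.mul_smul, Matrix.one_mul, gauge_mul_inv]
  simp [scale]

theorem perm_comp (σ τ : Equiv.Perm (Fin n)) : (perm σ).comp (perm τ) = perm (τ * σ) := by
  refine ext' (fun k j => ?_) fun k a => ?_
  · change dot ((perm τ).rank k) _ = _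
    rw [perm_rank, dot_stdRow]
    change (if _ then _ else _) = (if _ then _ else _)
    congr 1
    simp [Equiv.symm_apply_eq]
  · have h2 : (fun j => (((perm τ).gauge k ((perm σ).col j))⁻¹).1) = fun j => 1 := by
      funext j
      rw [show (perm τ).gauge k ((perm σ).col j) = 1 from rfl]
      simp
    have h3 := exchange_row (perm_rank τ k) (perm σ).rank a
      (dot_compRank (perm σ) (perm τ) k _).symm
    rw [comp_gauge, compGaugeMat, h2, blockTensor_one, Matrix.mul_one,
      show ((perm τ).gauge k ((perm σ).app a)).1 = 1 from rfl, Matrix.one_mul,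
      show (fun i => ((perm σ).gauge i a).1) = fun _ => 1 from rfl, blockTensor_one,
      Matrix.one_mul, h3, permMat_finCongr, castMat_mul, castMat_rfl, Matrix.one_mul]
    exact (Matrix.mul_one _).symm

end Mor

/-! ### Representations -/

/-- A quadruple `(n, ρ, β, c)`: a dimension `n ≥ 1`, a group morphism `ρ : π₀ → S_n`, a morphism
`β` of `π₀`-modules from `π₁` to `(ℂˣ)^n` with the action of `π₀` via `ρ`, and a normalized
2-cochain `c` with `∂c = β ∘ α`. -/
structure Rep (𝔾 : Type u) [Category.{v} 𝔾] [MonoidalCategory 𝔾] [SpecialTwoGroup 𝔾] where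
  n : ℕ
  one_le : 1 ≤ n
  ρ : PiZero 𝔾 →* Equiv.Perm (Fin n)
  β : Aut (𝟙_ 𝔾) →* (Fin n → ℂˣ)
  β_act : ∀ (g : PiZero 𝔾) (x : Aut (𝟙_ 𝔾)) (i : Fin n), β (act (𝔾 := 𝔾) g x) i = β x ((ρ g)⁻¹ i)
  c : PiZero 𝔾 → PiZero 𝔾 → Fin n → ℂˣ
  c_one_left : ∀ g, c 1 g = 1
  c_one_right : ∀ g, c g 1 = 1
  c_coboundary : ∀ (g₁ g₂ g₃ : PiZero 𝔾) (i : Fin n),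
    c g₂ g₃ ((ρ g₁)⁻¹ i) * (c (g₁ * g₂) g₃ i)⁻¹ * c g₁ (g₂ * g₃) i * (c g₁ g₂ i)⁻¹ =
      β (cls (MonoidalCategory.associator (C := 𝔾) g₁ g₂ g₃).hom) i

namespace Rep
variable {𝔾 : Type u} [Category.{v} 𝔾] [MonoidalCategory 𝔾] [SpecialTwoGroup 𝔾] (R : Rep 𝔾)

/-- The dimension, as an object of `2Mat`. -/
abbrev obj : TwoMat := ⟨R.n⟩

/-- The 1-morphism `F(g) = (P(ρ(g)), I)`. -/
noncomputable def map (g : PiZero 𝔾) : R.obj ⟶ R.obj := Mor.perm (R.ρ g)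

theorem map_eq {g h : 𝔾} (f : g ⟶ h) : R.map g = R.map h := by rw [eq_of_hom f]

theorem map_mul (g h : PiZero 𝔾) : R.map h ≫ R.map g = R.map (g * h) := by
  refine (Mor.perm_comp _ _).trans ?_
  rw [map, _root_.map_mul]

theorem map_one : R.map 1 = 𝟙 R.obj := by
  rw [map, _root_.map_one]; rfl

/-- The 2-morphism `F(f)`, with entries `β(γ⁻¹ f)_i` times the identity. -/
noncomputable def map₂ {g h : 𝔾} (f : g ⟶ h) : R.map g ⟶ R.map h :=
  Mor.scale (R.map_eq f) (R.β (cls f))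

/-- The 2-isomorphism `F(g ⊗ h) ≅ F(g) ∘ F(h)`; its inverse is `F₂(g, h) : F(g) ∘ F(h) ⇒ F(g ⊗ h)`,
with entries `c(g, h)_i` times the identity. -/
noncomputable def mapComp (g h : PiZero 𝔾) : R.map (g * h) ≅ R.map h ≫ R.map g where
  hom := Mor.scale (R.map_mul g h).symm (R.c g h)⁻¹
  inv := Mor.scale (R.map_mul g h) (R.c g h)
  hom_inv_id := by
    refine (Mor.scale_comp _ _ _ _).trans ?_
    rw [inv_mul_cancel, Mor.scale_one]; rfl
  inv_hom_id := by
    refine (Mor.scale_comp _ _ _ _).trans ?_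
    rw [mul_inv_cancel, Mor.scale_one]; rfl

open Bicategory

/-- `T` is one of the 2-morphisms `Mor.scale`. -/
def IsScale {X Y : TwoMat} {f g : X ⟶ Y} (T : f ⟶ g) (x : Fin Y.dim → ℂˣ) : Prop :=
  ∃ e : f = g, T = Mor.scale e x

theorem IsScale.comp {X Y : TwoMat} {f g h : X ⟶ Y} {T : f ⟶ g} {U : g ⟶ h}
    {x y : Fin Y.dim → ℂˣ} (hT : IsScale T x) (hU : IsScale U y) : IsScale (T ≫ U) (x * y) := by
  obtain ⟨e, rfl⟩ := hT
  obtain ⟨e', rfl⟩ := hU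
  exact ⟨e.trans e', Mor.scale_comp e e' x y⟩

theorem IsScale.eq {X Y : TwoMat} {f g : X ⟶ Y} {T U : f ⟶ g}
    {x y : Fin Y.dim → ℂˣ} (hT : IsScale T x) (hU : IsScale U y) (h : x = y) : T = U := by
  obtain ⟨e, rfl⟩ := hT
  obtain ⟨e', rfl⟩ := hU
  rw [h]

theorem isScale_eqToHom {X Y : TwoMat} {f g : X ⟶ Y} (e : f = g) : IsScale (eqToHom e) 1 :=
  ⟨e, (Mor.scale_one e).symm⟩

theorem isScale_associator {X Y Z W : TwoMat} (f : X ⟶ Y) (g : Y ⟶ Z) (h : Z ⟶ W) :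
    IsScale (Bicategory.associator f g h).hom 1 :=
  isScale_eqToHom (Mor.comp_assoc f g h)

theorem isScale_leftUnitor {X Y : TwoMat} (f : X ⟶ Y) :
    IsScale (Bicategory.leftUnitor f).hom 1 :=
  isScale_eqToHom (Mor.id_comp f)

theorem isScale_rightUnitor {X Y : TwoMat} (f : X ⟶ Y) :
    IsScale (Bicategory.rightUnitor f).hom 1 :=
  isScale_eqToHom (Mor.comp_id f)

theorem IsScale.whiskerLeft {X Y Z : TwoMat} (f : X ⟶ Y) {g h : Y ⟶ Z} {T : g ⟶ h}
    {x : Fin Z.dim → ℂˣ} (hT : IsScale T x) : IsScale (f ◁ T) x := by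
  obtain ⟨e, rfl⟩ := hT
  exact ⟨by rw [e], Mor.hcomp_scaleR (rfl : f = f) e x⟩

theorem IsScale.whiskerRight {X : TwoMat} {f f' : X ⟶ R.obj} {T : f ⟶ f'}
    {x : Fin R.n → ℂˣ} (hT : IsScale T x) (g : PiZero 𝔾) :
    IsScale (T ▷ R.map g) (fun i => x ((R.ρ g)⁻¹ i)) := by
  obtain ⟨e, rfl⟩ := hT
  exact ⟨by rw [e], Mor.hcomp_scaleL e (rfl : R.map g = R.map g) x⟩

theorem isScale_map₂ {g h : 𝔾} (f : g ⟶ h) : IsScale (R.map₂ f) (R.β (cls f)) := ⟨_, rfl⟩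

theorem isScale_mapComp_hom (g h : PiZero 𝔾) : IsScale (R.mapComp g h).hom (R.c g h)⁻¹ :=
  ⟨(R.map_mul g h).symm, rfl⟩

theorem isScale_mapComp_inv (g h : PiZero 𝔾) : IsScale (R.mapComp g h).inv (R.c g h) :=
  ⟨R.map_mul g h, rfl⟩

theorem c_congr {g g' h h' : 𝔾} (a : g ⟶ g') (b : h ⟶ h') : R.c g h = R.c g' h' := by
  rw [eq_of_hom a, eq_of_hom b]

open Bicategory

/-- The 2-matrix representation of a quadruple: the pseudofunctor from the one-object bicategory of
the 2-group to `2Mat` given by `g ↦ (P(ρ(g)), I)`, `f ↦ β(γ⁻¹ f)` and `F₂ = c`. -/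
noncomputable def toPseudofunctor : Pseudofunctor (Deloop 𝔾) TwoMat where
  obj _ := R.obj
  map g := R.map g
  map₂ f := R.map₂ (𝔾 := 𝔾) f
  mapId _ := eqToIso R.map_one
  mapComp f g := R.mapComp g f
  map₂_id g := by
    refine (congrArg (Mor.scale _) ?_).trans (Mor.scale_one rfl)
    exact (congrArg R.β (cls_id (𝔾 := 𝔾) g)).trans (_root_.map_one _)
  map₂_comp f g := by
    refine Eq.trans ?_ (Mor.scale_comp _ _ _ _).symm
    refine congrArg (Mor.scale _) ?_
    exact (congrArg R.β (cls_comp (𝔾 := 𝔾) f g)).trans ((_root_.map_mul _ _ _).trans (mul_comm _ _))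
  map₂_whisker_left f g h η := by
    refine IsScale.eq (R.isScale_map₂ _) ((R.isScale_mapComp_hom _ _).comp
      (((R.isScale_map₂ (𝔾 := 𝔾) η).whiskerLeft _).comp (R.isScale_mapComp_inv _ _))) ?_
    have h1 : R.β (cls (𝔾 := 𝔾) (Bicategory.whiskerLeft f η)) = R.β (cls (𝔾 := 𝔾) η) :=
      congrArg R.β (cls_whiskerRight (𝔾 := 𝔾) η f)
    have h2 : R.c g f = R.c h f := R.c_congr (𝔾 := 𝔾) η (𝟙 f)
    rw [h1, h2, mul_comm, mul_assoc, mul_inv_cancel, mul_one]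
  map₂_whisker_right {_ _ _ f g} η h := by
    refine IsScale.eq (R.isScale_map₂ _) ((R.isScale_mapComp_hom _ _).comp
      ((R.isScale_map₂ (𝔾 := 𝔾) η).whiskerRight R h |>.comp (R.isScale_mapComp_inv _ _))) ?_
    have h1 : R.β (cls (𝔾 := 𝔾) (Bicategory.whiskerRight η h)) = fun i => R.β (cls (𝔾 := 𝔾) η) ((R.ρ h)⁻¹ i) := by
      funext i
      refine Eq.trans ?_ (R.β_act h _ i)
      exact congrArg (fun t => R.β t i) (cls_whiskerLeft (𝔾 := 𝔾) h η)
    have h2 : R.c h f = R.c h g := R.c_congr (𝔾 := 𝔾) (𝟙 h) η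
    rw [h1, h2, mul_comm, mul_assoc, mul_inv_cancel, mul_one]
  map₂_associator f g h := by
    refine IsScale.eq (R.isScale_map₂ _) ((R.isScale_mapComp_hom _ _).comp
      (((R.isScale_mapComp_hom _ _).whiskerRight R h).comp ((isScale_associator _ _ _).comp
      (((R.isScale_mapComp_inv _ _).whiskerLeft _).comp (R.isScale_mapComp_inv _ _))))) ?_
    funext i
    have h1 : R.β (cls (𝔾 := 𝔾) (Bicategory.associator f g h).hom) =
        (R.β (cls (MonoidalCategory.associator (C := 𝔾) h g f).hom))⁻¹ :=
      (congrArg R.β (cls_inv (MonoidalCategory.associator (C := 𝔾) h g f))).trans (map_inv _ _)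
    have h2 := R.c_coboundary h g f i
    rw [h1, Pi.inv_apply, ← h2]
    simp only [Pi.mul_apply, Pi.inv_apply, one_mul, _root_.mul_inv_rev, inv_inv]
    change _ = (R.c h (HMul.hMul (α := PiZero 𝔾) (β := PiZero 𝔾) g f) i)⁻¹ *
      ((R.c g f ((R.ρ h)⁻¹ i))⁻¹ *
      (R.c h g i * R.c (HMul.hMul (α := PiZero 𝔾) (β := PiZero 𝔾) h g) f i))
    ac_rfl
  map₂_left_unitor f := by
    refine IsScale.eq (R.isScale_map₂ _) ((R.isScale_mapComp_hom _ _).comp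
      (((isScale_eqToHom R.map_one).whiskerRight R f).comp (isScale_leftUnitor _))) ?_
    have h1 : R.β (cls (𝔾 := 𝔾) (Bicategory.leftUnitor f).hom) = 1 :=
      (congrArg R.β (cls_rightUnitor (𝔾 := 𝔾) f)).trans (_root_.map_one _)
    have h2 : R.c f (𝟙_ 𝔾) = 1 := R.c_one_right f
    refine h1.trans ?_
    change _ = (R.c f (𝟙_ 𝔾))⁻¹ * (1 * 1)
    rw [h2, inv_one, mul_one, mul_one]
  map₂_right_unitor f := by
    refine IsScale.eq (R.isScale_map₂ _) ((R.isScale_mapComp_hom _ _).comp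
      (((isScale_eqToHom R.map_one).whiskerLeft _).comp (isScale_rightUnitor _))) ?_
    have h1 : R.β (cls (𝔾 := 𝔾) (Bicategory.rightUnitor f).hom) = 1 :=
      (congrArg R.β (cls_leftUnitor (𝔾 := 𝔾) f)).trans (_root_.map_one _)
    have h2 : R.c (𝟙_ 𝔾) f = 1 := R.c_one_left f
    refine h1.trans ?_
    change _ = (R.c (𝟙_ 𝔾) f)⁻¹ * (1 * 1)
    rw [h2, inv_one, mul_one, mul_one]

end Rep

/-! ### Projective equivariant bundles -/

/-- 2-cocycles of `G` with values in the `G`-module of functions `X → ℂˣ`, where `X` is a right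
`G`-set and `(g · f) x = f (x · g)`. A right action is an action of `Gᵐᵒᵖ`. -/
structure TwoCocycle (G X : Type*) [Group G] [MulAction Gᵐᵒᵖ X] where
  toFun : G → G → X → ℂˣ
  cocycle : ∀ (g₁ g₂ g₃ : G) (x : X),
    toFun g₂ g₃ (MulOpposite.op g₁ • x) * (toFun (g₁ * g₂) g₃ x)⁻¹ *
      toFun g₁ (g₂ * g₃) x * (toFun g₁ g₂ x)⁻¹ = 1

/-- Complex vector bundles over the (discrete) right `G`-set `X` with a projective right action of `G`
of cocycle `z`, covering the action on `X`: families of finite dimensional spaces with linear maps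
`act g x y : E_x → E_y` for `y = x · g`, such that `e · 1 = e` and
`e · (g₁ g₂) = z(g₁, g₂)(x) ((e · g₁) · g₂)` for `e ∈ E_x`. -/
structure PBund (G X : Type*) [Group G] [MulAction Gᵐᵒᵖ X] (z : TwoCocycle G X) where
  fiber : X → Type
  [addCommGroup : ∀ x, AddCommGroup (fiber x)]
  [module : ∀ x, Module ℂ (fiber x)]
  [finiteDimensional : ∀ x, FiniteDimensional ℂ (fiber x)]
  act : ∀ (g : G) (x y : X), MulOpposite.op g • x = y → fiber x →ₗ[ℂ] fiber y
  act_one : ∀ (x : X) (h : MulOpposite.op (1 : G) • x = x) (e : fiber x), act 1 x x h e = e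
  act_mul : ∀ (g₁ g₂ : G) (x y w : X) (h₁ : MulOpposite.op g₁ • x = y)
    (h₂ : MulOpposite.op g₂ • y = w) (h : MulOpposite.op (g₁ * g₂) • x = w) (e : fiber x),
    act (g₁ * g₂) x w h e = (z.toFun g₁ g₂ x : ℂ) • act g₂ y w h₂ (act g₁ x y h₁ e)

namespace PBund
variable {G X : Type*} [Group G] [MulAction Gᵐᵒᵖ X] {z : TwoCocycle G X}

attribute [instance] PBund.addCommGroup PBund.module PBund.finiteDimensional

/-- Morphisms of vector bundles (over the identity) preserving the projective actions. -/
@[ext] structure Hom (E F : PBund G X z) where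
  app : ∀ x, E.fiber x →ₗ[ℂ] F.fiber x
  comm : ∀ (g : G) (x y : X) (h : MulOpposite.op g • x = y) (e : E.fiber x),
    app y (E.act g x y h e) = F.act g x y h (app x e)

instance : Category (PBund G X z) where
  Hom := Hom
  id E := ⟨fun _ => LinearMap.id, fun _ _ _ _ _ => rfl⟩
  comp T U := ⟨fun x => U.app x ∘ₗ T.app x, fun g x y h e => by
    simp only [LinearMap.comp_apply, T.comm g x y h e, U.comm g x y h]⟩

end PBund

variable {𝔾 : Type u} [Category.{v} 𝔾] [MonoidalCategory 𝔾] [SpecialTwoGroup 𝔾]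

theorem cocycle_aux {A : Type*} [CommGroup A] {a b d e a' b' d' e' : A}
    (h : a' * b'⁻¹ * d' * e'⁻¹ = a * b⁻¹ * d * e⁻¹) :
    (a' / a) * (b' / b)⁻¹ * (d' / d) * (e' / e)⁻¹ = 1 := by
  have e : (a' / a) * (b' / b)⁻¹ * (d' / d) * (e' / e)⁻¹ =
      (a' * b'⁻¹ * d' * e'⁻¹) / (a * b⁻¹ * d * e⁻¹) := by
    simp only [div_eq_mul_inv, mul_inv, inv_inv, mul_comm, mul_left_comm, mul_assoc]
  rw [e, h, div_self']

/-- The set of pairs `(i', i)` with `1 ≤ i' ≤ n'` and `1 ≤ i ≤ n`. -/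
def PairSet (R R' : Rep 𝔾) : Type := Fin R'.n × Fin R.n

/-- The right action `(i', i) · g = (ρ'(g)⁻¹ i', ρ(g)⁻¹ i)`. -/
noncomputable instance (R R' : Rep 𝔾) : MulAction (PiZero 𝔾)ᵐᵒᵖ (PairSet R R') where
  smul g p := ((R'.ρ g.unop)⁻¹ p.1, (R.ρ g.unop)⁻¹ p.2)
  one_smul p := by
    change ((R'.ρ 1)⁻¹ p.1, (R.ρ 1)⁻¹ p.2) = p
    simp only [map_one, inv_one]
    rfl
  mul_smul g h p := by
    change ((R'.ρ (h.unop * g.unop))⁻¹ p.1, (R.ρ (h.unop * g.unop))⁻¹ p.2) =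
      ((R'.ρ g.unop)⁻¹ ((R'.ρ h.unop)⁻¹ p.1), (R.ρ g.unop)⁻¹ ((R.ρ h.unop)⁻¹ p.2))
    simp only [map_mul, _root_.mul_inv_rev, Equiv.Perm.mul_apply]

/-- The orbits all of whose points `(i', i)` satisfy `β'_{i'} = β_i`. -/
def IntertwiningOrbit (R R' : Rep 𝔾) : Type :=
  {O : MulAction.orbitRel.Quotient (PiZero 𝔾)ᵐᵒᵖ (PairSet R R') //
    ∀ p : PairSet R R', p ∈ O.orbit → ∀ x : Aut (𝟙_ 𝔾), R'.β x p.1 = R.β x p.2}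

/-- The 2-cocycle `z_O(g₁, g₂)(i', i) = c'(g₁, g₂)_{i'} / c(g₁, g₂)_i` of an intertwining orbit. -/
noncomputable def orbitCocycle (R R' : Rep 𝔾) (O : IntertwiningOrbit R R') :
    TwoCocycle (PiZero 𝔾) O.1.orbit where
  toFun g₁ g₂ p := R'.c g₁ g₂ p.1.1 / R.c g₁ g₂ p.1.2
  cocycle g₁ g₂ g₃ p := by
    have h := R.c_coboundary g₁ g₂ g₃ p.1.2
    have h' := R'.c_coboundary g₁ g₂ g₃ p.1.1
    rw [O.2 p.1 p.2, ← h] at h'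
    exact cocycle_aux h'

section
open scoped Pseudofunctor.StrongTrans

/-- The 1-intertwiners: pseudonatural transformations between the representations. -/
abbrev Rep.Intertwiner (R R' : Rep 𝔾) := R.toPseudofunctor ⟶ R'.toPseudofunctor

/-- The category of morphisms between two representations: its morphisms, the 2-intertwiners, are
the modifications. -/
noncomputable instance (R R' : Rep 𝔾) : Category (R.Intertwiner R') :=
  Pseudofunctor.StrongTrans.homCategory

end

end TwoRep

open CategoryTheory MonoidalCategory TwoRep

/-!
An intertwiner `F → F'` consists of a 1-morphism `X : n → n'` of `2Mat` and of invertible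
2-morphisms `F(g) ≫ X ⟶ X ≫ F'(g)`. The 1-morphisms `F(g)`, `F'(g)` are permutation matrices
with trivial gauge, so the source of this 2-morphism has rank `X_{i', ρ(g) j}` in the entry
`(i', j)` and its target has rank `X_{ρ'(g)⁻¹ i', j}`. Putting `i = ρ(g) j`, the 2-morphism is a
family of matrices `ℂ^(X_p) → ℂ^(X_{p · g})` indexed by the pairs `p = (i', i)` (`twist`). The gauge
of `X` disappears from all equations: in the horizontal composites that occur it is evaluated at the
columns of a permutation matrix, on which gauges are normalized (`Mor.block_hcomp_left`).

In terms of these matrices the axioms of a pseudonatural transformation read as follows.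
* The unit axiom says that the matrices of `1` are identities (`naturality_id_iff`).
* The composition axiom says that the matrices are multiplicative up to the factor `c' / c`
  (`naturality_comp_iff`).
* Naturality in the 2-morphisms says that `β'_{i'}` and `β_i` agree wherever the rank is nonzero
  (`naturality_naturality_iff`, `Intertwiner.intertwining_of_dim_ne_zero`).

Hence the ranks vanish outside the intertwining orbits, and over each of these the spaces `ℂ^(X_p)`
form a projective equivariant bundle. Modifications are families of matrices commuting with the
actions (`modification_naturality_iff`), so the resulting functor `Intertwiner.toBundles` is fully
faithful. It is essentially surjective because, after a choice of bases of the fibres, a family of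
bundles is a system of matrices of this kind; the matrix of `g` is invertible, its inverse being
a multiple of that of `g⁻¹` (`MatrixSystem.exists_inv`).
-/

namespace TwoRep

open Matrix SpecialTwoGroup Bicategory

/-! ### Entries of 2-morphisms with prescribed sizes -/

namespace Mor

variable {n m p : ℕ}

/-- The `(i, j)` entry of a 2-morphism, with its rows and columns indexed by `Fin b` and `Fin a`
for any `a`, `b` *propositionally* equal to the ranks. Composites of 1-morphisms with permutation
matrices have ranks that simplify only propositionally, so that this form of the entries
is the one in which 2-morphisms between different composites can be multiplied. -/
def block {f g : Mor n m} (T : f ⟶ g) (i : Fin m) (j : Fin n) {a b : ℕ} (ha : f.rank i j = a)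
    (hb : g.rank i j = b) : Matrix (Fin b) (Fin a) ℂ :=
  (Hom2.entry T i j).submatrix (Fin.cast hb.symm) (Fin.cast ha.symm)

theorem hom_ext_block {f g : Mor n m} {T U : f ⟶ g}
    (h : ∀ i j, ∃ (a b : ℕ) (ha : f.rank i j = a) (hb : g.rank i j = b),
      block T i j ha hb = block U i j ha hb) : T = U := by
  refine hom_ext fun i j => ?_
  obtain ⟨a, b, ha, hb, h⟩ := h i j
  subst ha hb
  exact h

theorem block_comp {f g h : Mor n m} (T : f ⟶ g) (U : g ⟶ h) (i : Fin m) (j : Fin n) {a b c : ℕ}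
    (ha : f.rank i j = a) (hb : g.rank i j = b) (hc : h.rank i j = c) :
    block (T ≫ U) i j ha hc = block U i j hb hc * block T i j ha hb := by
  subst ha hb hc
  rfl

theorem block_id (f : Mor n m) (i : Fin m) (j : Fin n) {a : ℕ} (ha ha' : f.rank i j = a) :
    block (𝟙 f) i j ha ha' = 1 := by
  subst ha
  rfl

theorem block_scale {f g : Mor n m} (e : f = g) (x : Fin m → ℂˣ) (i : Fin m) (j : Fin n) {a : ℕ}
    (ha : f.rank i j = a) (hb : g.rank i j = a) :
    block (scale e x) i j ha hb = (x i : ℂ) • 1 := by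
  subst e ha
  simp [block, scale]

theorem gauge_eq_one (f : Mor n m) (i : Fin m) {a : Fin n → ℕ} {k : Fin n} (h : a = stdVec k) :
    f.gauge i a = 1 := by
  subst h
  exact f.gauge_stdVec i k

theorem blockTensor_stdVec_smul {r r' a : Fin n → ℕ} {k : Fin n} (h : a = stdVec k)
    (A : ∀ i, Matrix (Fin (r' i)) (Fin (r i)) ℂ) (x : Fin n → ℂ) (hr : dot r a = r k)
    (hr' : dot r' a = r' k) :
    blockTensor (a := a) (a' := a) A (fun i => x i • 1) =
      x k • (A k).submatrix (Fin.cast hr') (Fin.cast hr) := by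
  subst h
  have h1 : blockTensor (a := stdVec k) (a' := stdVec k) A (fun i => x i • 1) =
      blockTensor (a := stdVec k) (a' := stdVec k) (fun i => x i • A i) (fun _ => 1) := by
    simp only [blockTensor, Matrix.smul_kronecker, Matrix.kronecker_smul]
  rw [h1, blockTensor_stdVec, castMat, castMat, permMat_mul, mul_permMat]
  rfl

theorem dot_of_stdVec {r a : Fin n → ℕ} {k : Fin n} (h : a = stdVec k) : dot r a = r k := by
  subst h
  exact dot_stdVec r k

theorem dot_of_stdRow {r a : Fin n → ℕ} {k : Fin n} (h : r = stdRow k) : dot r a = a k := by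
  subst h
  exact dot_stdRow a k

/-- Whiskering on the side of the source by a 1-morphism whose `j`-th column is a canonical vector
`e_k`: the gauges do not contribute, since they are normalized on canonical vectors. -/
theorem block_hcomp_left {f f' : Mor n m} {g g' : Mor m p} (e : f = f') (x : Fin m → ℂˣ)
    (T : g ⟶ g') (i : Fin p) (j : Fin n) {k : Fin m} (hk : f.col j = stdVec k) {a b : ℕ}
    (ha : (f.comp g).rank i j = a) (hb : (f'.comp g').rank i j = b)
    (ha' : g.rank i k = a) (hb' : g'.rank i k = b) :
    block (hcomp (scale e x) T) i j ha hb = (x k : ℂ) • block T i k ha' hb' := by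
  subst e
  have h0 : (fun i => Hom2.entry (scale rfl x : f ⟶ f) i j) = fun i => (x i : ℂ) • 1 := by
    funext i
    simp [scale]
  rw [block, hcomp_entry, gauge_eq_one g' i hk, gauge_eq_one g i hk, inv_one, Units.val_one,
    Units.val_one, Matrix.one_mul, Matrix.mul_one, h0]
  erw [blockTensor_stdVec_smul hk _ (fun i => (x i : ℂ)) (dot_of_stdVec hk) (dot_of_stdVec hk)]
  subst ha' hb'
  rfl

/-- Whiskering on the side of the target by a permutation matrix, whose gauge is trivial. -/
theorem block_hcomp_right {f f' : Mor n m} (T : f ⟶ f') (τ : Equiv.Perm (Fin m)) (i : Fin m)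
    (j : Fin n) {a b : ℕ}
    (ha : (f.comp (perm τ)).rank i j = a) (hb : (f'.comp (perm τ)).rank i j = b)
    (ha' : f.rank (τ⁻¹ i) j = a) (hb' : f'.rank (τ⁻¹ i) j = b) :
    block (hcomp T (𝟙 (perm τ))) i j ha hb = block T (τ⁻¹ i) j ha' hb' := by
  have key : ∀ {r : Fin m → ℕ} (h : r = stdRow (τ⁻¹ i)) (h1 : dot r (f.col j) = f.col j (τ⁻¹ i))
      (h2 : dot r (f'.col j) = f'.col j (τ⁻¹ i)),
      blockTensor (r := r) (r' := r) (a := f.col j) (a' := f'.col j) (fun _ => 1)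
        (fun k => Hom2.entry T k j) =
        (Hom2.entry T (τ⁻¹ i) j).submatrix (Fin.cast h2) (Fin.cast h1) := by
    intro r h h1 h2
    subst h
    rw [blockTensor_stdRow, castMat, castMat, permMat_mul, mul_permMat]
    rfl
  rw [block, hcomp_entry]
  have g1 : ((perm τ).gauge i (f'.col j)).1 = 1 := rfl
  have g2 : (((perm τ).gauge i (f.col j))⁻¹).1 = 1 := by
    rw [show (perm τ).gauge i (f.col j) = 1 from rfl]; simp
  rw [g1, g2, Matrix.one_mul, Matrix.mul_one]
  have h := perm_rank τ i
  have := key h (dot_of_stdRow h) (dot_of_stdRow h)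
  erw [this]
  subst ha' hb'
  rfl

end Mor

open Mor

/-! ### Pseudonaturality in terms of blocks -/

/-- The rank matrix of a 1-morphism of `2Mat`. -/
abbrev TwoMat.rank {A B : TwoMat} (f : A ⟶ B) : Fin B.dim → Fin A.dim → ℕ := Mor.rank f

variable {𝔾 : Type u} [Category.{v} 𝔾] [MonoidalCategory 𝔾] [SpecialTwoGroup 𝔾] {R R' : Rep 𝔾}

theorem PairSet.fst_eq_of_smul {g : PiZero 𝔾} {p q : PairSet R R'}
    (h : MulOpposite.op g • p = q) : (R'.ρ g)⁻¹ p.1 = q.1 := congrArg Prod.fst h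

theorem PairSet.snd_eq_of_smul {g : PiZero 𝔾} {p q : PairSet R R'}
    (h : MulOpposite.op g • p = q) : R.ρ g q.2 = p.2 := by
  rw [← show (R.ρ g)⁻¹ p.2 = q.2 from congrArg Prod.snd h]
  exact Equiv.apply_symm_apply _ _

theorem Rep.rank_map_comp_apply {g : PiZero 𝔾} (X : R.obj ⟶ R'.obj) (i : Fin R'.n)
    {j k : Fin R.n} (h : R.ρ g j = k) : TwoMat.rank (R.map g ≫ X) i j = TwoMat.rank X i k :=
  (dot_stdVec _ _).trans (congrArg (TwoMat.rank X i) h)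

theorem Rep.rank_comp_map_apply {g : PiZero 𝔾} (X : R.obj ⟶ R'.obj) {i k : Fin R'.n}
    (j : Fin R.n) (h : (R'.ρ g)⁻¹ i = k) : TwoMat.rank (X ≫ R'.map g) i j = TwoMat.rank X k j :=
  (dot_of_stdRow (perm_rank (R'.ρ g) i)).trans (congrArg (fun i => TwoMat.rank X i j) h)

theorem Rep.rank_map_comp {g : PiZero 𝔾} {p q : PairSet R R'} (h : MulOpposite.op g • p = q)
    (X : R.obj ⟶ R'.obj) : TwoMat.rank (R.map g ≫ X) p.1 q.2 = TwoMat.rank X p.1 p.2 :=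
  Rep.rank_map_comp_apply X p.1 (PairSet.snd_eq_of_smul h)

theorem Rep.rank_comp_map {g : PiZero 𝔾} {p q : PairSet R R'} (h : MulOpposite.op g • p = q)
    (X : R.obj ⟶ R'.obj) : TwoMat.rank (X ≫ R'.map g) p.1 q.2 = TwoMat.rank X q.1 q.2 :=
  Rep.rank_comp_map_apply X q.2 (PairSet.fst_eq_of_smul h)

/-- The matrix `ℂ^(X_p) → ℂ^(Y_q)`, for `q = p · g`, of a 2-morphism `F(g) ≫ X ⟶ Y ≫ F'(g)`. With
`p = (i', i)` and `q = (j', j)` this is its `(i', j)` entry: the source has rank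
`X_{i', ρ(g) j} = X_p` there and the target has rank `Y_{ρ'(g)⁻¹ i', j} = Y_q`. -/
noncomputable def twist {X Y : R.obj ⟶ R'.obj} {g : PiZero 𝔾} (N : R.map g ≫ X ⟶ Y ≫ R'.map g)
    (p q : PairSet R R') (h : MulOpposite.op g • p = q) :
    Matrix (Fin (TwoMat.rank Y q.1 q.2)) (Fin (TwoMat.rank X p.1 p.2)) ℂ :=
  block N p.1 q.2 (Rep.rank_map_comp h X) (Rep.rank_comp_map h Y)

variable {X Y Z : R.obj ⟶ R'.obj} {g : PiZero 𝔾}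

/-- Every entry of a 2-morphism `F(g) ≫ X ⟶ Y ≫ F'(g)` lies over some `p ↦ p · g`. -/
theorem PairSet.exists_of_fst_snd (g : PiZero 𝔾) (i : Fin R'.n) (j : Fin R.n) :
    ∃ p q : PairSet R R', MulOpposite.op g • p = q ∧ p.1 = i ∧ q.2 = j :=
  ⟨(i, R.ρ g j), _, rfl, rfl, Equiv.symm_apply_apply _ _⟩

theorem twist_injective {N N' : R.map g ≫ X ⟶ Y ≫ R'.map g}
    (h : ∀ p q (h : MulOpposite.op g • p = q), twist N p q h = twist N' p q h) : N = N' := by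
  refine hom_ext_block fun i j => ?_
  obtain ⟨p, q, hpq, rfl, rfl⟩ := PairSet.exists_of_fst_snd (R := R) (R' := R') g i j
  exact ⟨_, _, _, _, h p q hpq⟩

/-- The 2-morphism with prescribed matrices. -/
noncomputable def ofTwist
    (A : ∀ p q : PairSet R R', MulOpposite.op g • p = q →
      Matrix (Fin (TwoMat.rank Y q.1 q.2)) (Fin (TwoMat.rank X p.1 p.2)) ℂ) :
    R.map g ≫ X ⟶ Y ≫ R'.map g :=
  Hom2.mk fun i j =>
    have h : MulOpposite.op g • (show PairSet R R' from (i, R.ρ g j)) = ((R'.ρ g)⁻¹ i, j) :=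
      Prod.ext rfl (Equiv.symm_apply_apply _ _)
    (A _ _ h).submatrix (Fin.cast (Rep.rank_comp_map h Y)) (Fin.cast (Rep.rank_map_comp h X))

theorem twist_ofTwist (A : ∀ p q : PairSet R R', MulOpposite.op g • p = q →
      Matrix (Fin (TwoMat.rank Y q.1 q.2)) (Fin (TwoMat.rank X p.1 p.2)) ℂ) (p q h) :
    twist (ofTwist A) p q h = A p q h := by
  obtain ⟨i, k⟩ := p
  obtain ⟨k', j⟩ := q
  obtain rfl : (R'.ρ g)⁻¹ i = k' := PairSet.fst_eq_of_smul h
  obtain rfl : R.ρ g j = k := PairSet.snd_eq_of_smul h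
  rfl

/-- Whiskering a scalar 2-morphism by `X` multiplies by the scalar of the index `k` that the
`j`-th column selects. -/
theorem block_whiskerRight {f f' : R.obj ⟶ R.obj} {T : f ⟶ f'} {x : Fin R.n → ℂˣ}
    (hT : Rep.IsScale T x) (X : R.obj ⟶ R'.obj) (i : Fin R'.n) (j k : Fin R.n)
    (hk : Mor.col f j = stdVec k) {a : ℕ} (ha : TwoMat.rank (f ≫ X) i j = a)
    (hb : TwoMat.rank (f' ≫ X) i j = a) (ha' : TwoMat.rank X i k = a) :
    block (T ▷ X) i j ha hb = (x k : ℂ) • (1 : Matrix (Fin a) (Fin a) ℂ) := by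
  obtain ⟨e, rfl⟩ := hT
  exact (block_hcomp_left e x (𝟙 X) i j hk ha hb ha' ha').trans
    (congrArg _ (block_id X i k ha' ha'))

theorem Rep.IsScale.block {f f' : R.obj ⟶ R'.obj} {T : f ⟶ f'} {x : Fin R'.n → ℂˣ}
    (hT : Rep.IsScale T x) (i : Fin R'.n) (j : Fin R.n) {a : ℕ} (ha : TwoMat.rank f i j = a)
    (hb : TwoMat.rank f' i j = a) :
    Mor.block T i j ha hb = (x i : ℂ) • (1 : Matrix (Fin a) (Fin a) ℂ) := by
  obtain ⟨e, rfl⟩ := hT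
  exact block_scale e x i j ha hb

theorem block_whiskerLeft_map (T : X ⟶ Y) (i : Fin R'.n) (j k : Fin R.n) (hk : R.ρ g j = k)
    {a b : ℕ} (ha : TwoMat.rank (R.map g ≫ X) i j = a) (hb : TwoMat.rank (R.map g ≫ Y) i j = b)
    (ha' : TwoMat.rank X i k = a) (hb' : TwoMat.rank Y i k = b) :
    block (R.map g ◁ T) i j ha hb = block T i k ha' hb' := by
  subst hk
  have e : R.map g ◁ T = hcomp (scale rfl 1) T := by
    rw [scale_one]; rfl
  rw [e]
  exact (block_hcomp_left rfl 1 T i j rfl ha hb ha' hb').trans (one_smul _ _)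

theorem block_whiskerRight_map (T : X ⟶ Y) (i k : Fin R'.n) (j : Fin R.n)
    (hk : (R'.ρ g)⁻¹ i = k)
    {a b : ℕ} (ha : TwoMat.rank (X ≫ R'.map g) i j = a) (hb : TwoMat.rank (Y ≫ R'.map g) i j = b)
    (ha' : TwoMat.rank X k j = a) (hb' : TwoMat.rank Y k j = b) :
    block (T ▷ R'.map g) i j ha hb = block T k j ha' hb' := by
  subst hk
  exact block_hcomp_right T (R'.ρ g) i j ha hb ha' hb'

theorem twist_whiskerLeft_comp (Γ : X ⟶ Y) (N : R.map g ≫ Y ⟶ Z ≫ R'.map g) (p q h) :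
    twist (R.map g ◁ Γ ≫ N) p q h = twist N p q h * Hom2.entry Γ p.1 p.2 := by
  refine (block_comp (R.map g ◁ Γ) N p.1 q.2 _ (Rep.rank_map_comp h Y) _).trans
    (congrArg _ ?_)
  exact block_whiskerLeft_map Γ p.1 q.2 p.2 (PairSet.snd_eq_of_smul h) _ _ rfl rfl

theorem twist_comp_whiskerRight (N : R.map g ≫ X ⟶ Y ≫ R'.map g) (Γ : Y ⟶ Z) (p q h) :
    twist (N ≫ Γ ▷ R'.map g) p q h = Hom2.entry Γ q.1 q.2 * twist N p q h := by
  refine (block_comp N (Γ ▷ R'.map g) p.1 q.2 _ (Rep.rank_comp_map h Y) _).trans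
    (congrArg (· * _) ?_)
  exact block_whiskerRight_map Γ p.1 q.1 q.2 (PairSet.fst_eq_of_smul h) _ _ rfl rfl

/-- Entry by entry, the modification axiom says that the matrices of `Γ` intertwine those of `N`
and `N'`. -/
theorem modification_naturality_iff (N : R.map g ≫ X ⟶ X ≫ R'.map g)
    (N' : R.map g ≫ Y ⟶ Y ≫ R'.map g) (Γ : X ⟶ Y) :
    R.map g ◁ Γ ≫ N' = N ≫ Γ ▷ R'.map g ↔
      ∀ p q (h : MulOpposite.op g • p = q),
        Hom2.entry Γ q.1 q.2 * twist N p q h = twist N' p q h * Hom2.entry Γ p.1 p.2 := by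
  simp only [← twist_whiskerLeft_comp, ← twist_comp_whiskerRight]
  exact ⟨fun h p q hpq => by rw [h], fun h => twist_injective fun p q hpq => (h p q hpq).symm⟩

/-- Entry by entry, naturality in the 2-morphisms of the 2-group compares the scalars `β_i` and
`β'_{i'}`. -/
theorem naturality_naturality_iff (N : ∀ g : PiZero 𝔾, R.map g ≫ X ⟶ X ≫ R'.map g)
    {f g : 𝔾} (η : f ⟶ g) :
    R.map₂ (𝔾 := 𝔾) η ▷ X ≫ N g = N f ≫ X ◁ R'.map₂ (𝔾 := 𝔾) η ↔
      ∀ p q (hf : MulOpposite.op (α := PiZero 𝔾) f • p = q)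
        (hg : MulOpposite.op (α := PiZero 𝔾) g • p = q),
        (R.β (cls (𝔾 := 𝔾) η) p.2 : ℂ) • twist (N g) p q hg =
          (R'.β (cls (𝔾 := 𝔾) η) p.1 : ℂ) • twist (N f) p q hf := by
  have hl : ∀ p q (hf : MulOpposite.op (α := PiZero 𝔾) f • p = q)
      (hg : MulOpposite.op (α := PiZero 𝔾) g • p = q),
      block (R.map₂ (𝔾 := 𝔾) η ▷ X ≫ N g) p.1 q.2
        (Rep.rank_map_comp hf X) (Rep.rank_comp_map hg X) =
      (R.β (cls (𝔾 := 𝔾) η) p.2 : ℂ) • twist (N g) p q hg := fun p q hf hg => by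
    refine (block_comp (R.map₂ (𝔾 := 𝔾) η ▷ X) (N g) p.1 q.2 _ (Rep.rank_map_comp hg X) _).trans ?_
    rw [block_whiskerRight (R.isScale_map₂ (𝔾 := 𝔾) η) X p.1 q.2 p.2
      (congrArg stdVec (PairSet.snd_eq_of_smul hf)) _ _ rfl, Matrix.mul_smul, Matrix.mul_one]
    rfl
  have hr : ∀ p q (hf : MulOpposite.op (α := PiZero 𝔾) f • p = q)
      (hg : MulOpposite.op (α := PiZero 𝔾) g • p = q),
      block (N f ≫ X ◁ R'.map₂ (𝔾 := 𝔾) η) p.1 q.2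
        (Rep.rank_map_comp hf X) (Rep.rank_comp_map hg X) =
      (R'.β (cls (𝔾 := 𝔾) η) p.1 : ℂ) • twist (N f) p q hf := fun p q hf hg => by
    refine (block_comp (N f) (X ◁ R'.map₂ (𝔾 := 𝔾) η) p.1 q.2 _ (Rep.rank_comp_map hf X) _).trans ?_
    rw [((R'.isScale_map₂ (𝔾 := 𝔾) η).whiskerLeft X).block p.1 q.2, Matrix.smul_mul, Matrix.one_mul]
    rfl
  constructor
  · intro h p q hf hg
    rw [← hl p q hf hg, ← hr p q hf hg, h]
  · intro h
    refine hom_ext_block fun i j => ?_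
    obtain ⟨p, q, hpq, rfl, rfl⟩ := PairSet.exists_of_fst_snd (R := R) (R' := R') f i j
    have hg : MulOpposite.op (α := PiZero 𝔾) g • p = q :=
      (congrArg (fun a => MulOpposite.op (α := PiZero 𝔾) a • p)
        (eq_of_hom (𝔾 := 𝔾) η)).symm.trans hpq
    exact ⟨_, _, Rep.rank_map_comp hpq X, Rep.rank_comp_map hg X,
      ((hl p q hpq hg).trans (h p q hpq hg)).trans (hr p q hpq hg).symm⟩

/-- Entry by entry, the unit axiom of a pseudonatural transformation says that the unit acts
trivially. -/
theorem naturality_id_iff (N : R.map 1 ≫ X ⟶ X ≫ R'.map 1) :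
    N ≫ X ◁ eqToHom R'.map_one = eqToHom R.map_one ▷ X ≫ (Bicategory.leftUnitor X).hom ≫
        (Bicategory.rightUnitor X).inv ↔
      ∀ p (h : MulOpposite.op (1 : PiZero 𝔾) • p = p), twist N p p h = 1 := by
  have rk : ∀ p : PairSet R R', TwoMat.rank (X ≫ 𝟙 R'.obj) p.1 p.2 = TwoMat.rank X p.1 p.2 :=
    fun p => dot_stdRow _ _
  have hl : ∀ p (h : MulOpposite.op (1 : PiZero 𝔾) • p = p),
      block (N ≫ X ◁ eqToHom R'.map_one) p.1 p.2 (Rep.rank_map_comp h X) (rk p) = twist N p p h :=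
    fun p h => by
    refine (block_comp N (X ◁ eqToHom R'.map_one) p.1 p.2 _ (Rep.rank_comp_map h X) _).trans ?_
    rw [((Rep.isScale_eqToHom R'.map_one).whiskerLeft X).block p.1 p.2]
    simp only [Pi.one_apply, Units.val_one, one_smul, Matrix.one_mul]
    rfl
  have hr : ∀ p (h : MulOpposite.op (1 : PiZero 𝔾) • p = p),
      block (eqToHom R.map_one ▷ X ≫ (Bicategory.leftUnitor X).hom ≫
        (Bicategory.rightUnitor X).inv) p.1 p.2 (Rep.rank_map_comp h X) (rk p) = 1 := fun p h => by
    have h1 : Rep.IsScale (Bicategory.rightUnitor X).inv 1 :=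
      Rep.isScale_eqToHom (Mor.comp_id X).symm
    have h2 := (Rep.isScale_leftUnitor X).comp h1
    refine (block_comp _ _ p.1 p.2 _ (dot_stdVec _ _) _).trans ?_
    rw [h2.block p.1 p.2, block_whiskerRight (Rep.isScale_eqToHom R.map_one) X p.1 p.2 p.2
      (congrArg stdVec (PairSet.snd_eq_of_smul h)) _ _ rfl]
    simp
  constructor
  · intro e p h
    rw [← hl p h, e, hr p h]
  · intro h
    refine hom_ext_block fun i j => ?_
    have hp : MulOpposite.op (1 : PiZero 𝔾) • (show PairSet R R' from (i, j)) = (i, j) :=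
      one_smul _ _
    exact ⟨_, _, Rep.rank_map_comp hp X, rk (i, j), ((hl _ hp).trans (h _ hp)).trans (hr _ hp).symm⟩

theorem Rep.rank_comp_map_comp_map {g₁ g₂ : PiZero 𝔾} {p w : PairSet R R'}
    (h : MulOpposite.op (g₁ * g₂) • p = w) (X : R.obj ⟶ R'.obj) :
    TwoMat.rank (X ≫ R'.map g₂ ≫ R'.map g₁) p.1 w.2 = TwoMat.rank X w.1 w.2 := by
  rw [R'.map_mul g₁ g₂]
  exact Rep.rank_comp_map h X

/-- The entries of the left-hand side of the composition axiom. -/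
theorem block_comp_mapComp (N : ∀ g : PiZero 𝔾, R.map g ≫ X ⟶ X ≫ R'.map g)
    (g₁ g₂ : PiZero 𝔾) {T : R.map (g₁ * g₂) ≫ X ⟶ X ≫ R'.map g₂ ≫ R'.map g₁}
    (hT : T = N (g₁ * g₂) ≫ X ◁ (R'.mapComp g₁ g₂).hom) (p w : PairSet R R')
    (h : MulOpposite.op (g₁ * g₂) • p = w)
    (hw : TwoMat.rank (X ≫ R'.map g₂ ≫ R'.map g₁) p.1 w.2 = TwoMat.rank X w.1 w.2) :
    block T p.1 w.2 (Rep.rank_map_comp h X) hw =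
      (((R'.c g₁ g₂ p.1)⁻¹ : ℂˣ) : ℂ) • twist (N (g₁ * g₂)) p w h := by
  subst hT
  refine (block_comp (N (g₁ * g₂)) (X ◁ (R'.mapComp g₁ g₂).hom) p.1 w.2 _
    (Rep.rank_comp_map h X) _).trans ?_
  rw [((R'.isScale_mapComp_hom g₁ g₂).whiskerLeft X).block p.1 w.2, Matrix.smul_mul,
    Matrix.one_mul]
  rfl

/-- The entries of the right-hand side of the composition axiom. -/
theorem block_mapComp_comp (N : ∀ g : PiZero 𝔾, R.map g ≫ X ⟶ X ≫ R'.map g)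
    (g₁ g₂ : PiZero 𝔾) {T : R.map (g₁ * g₂) ≫ X ⟶ X ≫ R'.map g₂ ≫ R'.map g₁}
    (hT : T = (R.mapComp g₁ g₂).hom ▷ X ≫ (Bicategory.associator _ _ _).hom ≫ R.map g₂ ◁ N g₁ ≫
        (Bicategory.associator _ _ _).inv ≫ N g₂ ▷ R'.map g₁ ≫
        (Bicategory.associator _ _ _).hom) (p q w : PairSet R R')
    (h₁ : MulOpposite.op g₁ • p = q) (h₂ : MulOpposite.op g₂ • q = w)
    (h : MulOpposite.op (g₁ * g₂) • p = w)
    (hw : TwoMat.rank (X ≫ R'.map g₂ ≫ R'.map g₁) p.1 w.2 = TwoMat.rank X w.1 w.2) :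
    block T p.1 w.2 (Rep.rank_map_comp h X) hw =
      (((R.c g₁ g₂ p.2)⁻¹ : ℂˣ) : ℂ) • (twist (N g₂) q w h₂ * twist (N g₁) p q h₁) := by
  have e₁ := PairSet.fst_eq_of_smul h₁
  have e₂ := PairSet.snd_eq_of_smul h₂
  have r2 : TwoMat.rank (R.map g₂ ≫ R.map g₁ ≫ X) p.1 w.2 = TwoMat.rank X p.1 p.2 :=
    (Rep.rank_map_comp_apply _ p.1 e₂).trans (Rep.rank_map_comp h₁ X)
  have r1 : TwoMat.rank ((R.map g₂ ≫ R.map g₁) ≫ X) p.1 w.2 = TwoMat.rank X p.1 p.2 :=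
    (congrArg (fun f => TwoMat.rank f p.1 w.2)
      (Bicategory.Strict.assoc (R.map g₂) (R.map g₁) X)).trans r2
  have r3 : TwoMat.rank (R.map g₂ ≫ X ≫ R'.map g₁) p.1 w.2 = TwoMat.rank X q.1 q.2 :=
    (Rep.rank_map_comp_apply _ p.1 e₂).trans (Rep.rank_comp_map h₁ X)
  have r4 : TwoMat.rank ((R.map g₂ ≫ X) ≫ R'.map g₁) p.1 w.2 = TwoMat.rank X q.1 q.2 :=
    (Rep.rank_comp_map_apply _ w.2 e₁).trans (Rep.rank_map_comp h₂ X)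
  have r5 : TwoMat.rank ((X ≫ R'.map g₂) ≫ R'.map g₁) p.1 w.2 = TwoMat.rank X w.1 w.2 :=
    (Rep.rank_comp_map_apply _ w.2 e₁).trans (Rep.rank_comp_map h₂ X)
  have ai : Rep.IsScale (Bicategory.associator (R.map g₂) X (R'.map g₁)).inv 1 :=
    Rep.isScale_eqToHom (Mor.comp_assoc (R.map g₂) X (R'.map g₁)).symm
  have b5 := block_comp (N g₂ ▷ R'.map g₁)
    (Bicategory.associator X (R'.map g₂) (R'.map g₁)).hom p.1 w.2 r4 r5 hw
  have b4 := block_comp (Bicategory.associator (R.map g₂) X (R'.map g₁)).inv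
    (N g₂ ▷ R'.map g₁ ≫ (Bicategory.associator X (R'.map g₂) (R'.map g₁)).hom) p.1 w.2 r3 r4 hw
  have b3 := block_comp (R.map g₂ ◁ N g₁)
    ((Bicategory.associator (R.map g₂) X (R'.map g₁)).inv ≫
    N g₂ ▷ R'.map g₁ ≫ (Bicategory.associator X (R'.map g₂) (R'.map g₁)).hom) p.1 w.2 r2 r3 hw
  have b2 := block_comp (Bicategory.associator (R.map g₂) (R.map g₁) X).hom
    (R.map g₂ ◁ N g₁ ≫ (Bicategory.associator (R.map g₂) X (R'.map g₁)).inv ≫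
    N g₂ ▷ R'.map g₁ ≫ (Bicategory.associator X (R'.map g₂) (R'.map g₁)).hom) p.1 w.2 r1 r2 hw
  subst hT
  refine (block_comp ((R.mapComp g₁ g₂).hom ▷ X) _ p.1 w.2 _ r1 _).trans ?_
  refine (congrArg (· * _) (b2.trans (congrArg (· * _) (b3.trans (congrArg (· * _)
    (b4.trans (congrArg (· * _) b5))))))).trans ?_
  rw [(Rep.isScale_associator (R.map g₂) (R.map g₁) X).block p.1 w.2,
    (Rep.isScale_associator X (R'.map g₂) (R'.map g₁)).block p.1 w.2, ai.block p.1 w.2,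
    block_whiskerRight (R.isScale_mapComp_hom g₁ g₂) X p.1 w.2 p.2
    (congrArg stdVec (PairSet.snd_eq_of_smul h)) _ _ rfl,
    block_whiskerLeft_map (N g₁) p.1 w.2 q.2 e₂ _ _ (Rep.rank_map_comp h₁ X)
      (Rep.rank_comp_map h₁ X),
    block_whiskerRight_map (N g₂) p.1 q.1 w.2 e₁ _ _ (Rep.rank_map_comp h₂ X)
      (Rep.rank_comp_map h₂ X)]
  simp only [Pi.one_apply, Units.val_one, one_smul, Matrix.one_mul, Matrix.mul_one,
    Matrix.mul_smul]
  rfl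

/-- Entry by entry, the composition axiom of a pseudonatural transformation is the multiplicativity
of a projective action of cocycle `c' / c`. Its two sides are taken as variables `T` and `U`,
because unfolding them as composites during unification is expensive. -/
theorem naturality_comp_iff (N : ∀ g : PiZero 𝔾, R.map g ≫ X ⟶ X ≫ R'.map g)
    (g₁ g₂ : PiZero 𝔾) {T U : R.map (g₁ * g₂) ≫ X ⟶ X ≫ R'.map g₂ ≫ R'.map g₁}
    (hT : T = N (g₁ * g₂) ≫ X ◁ (R'.mapComp g₁ g₂).hom)
    (hU : U = (R.mapComp g₁ g₂).hom ▷ X ≫ (Bicategory.associator _ _ _).hom ≫ R.map g₂ ◁ N g₁ ≫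
        (Bicategory.associator _ _ _).inv ≫ N g₂ ▷ R'.map g₁ ≫
        (Bicategory.associator _ _ _).hom) :
    T = U ↔
      ∀ p q w (h₁ : MulOpposite.op g₁ • p = q) (h₂ : MulOpposite.op g₂ • q = w)
        (h : MulOpposite.op (g₁ * g₂) • p = w),
        twist (N (g₁ * g₂)) p w h = ((R'.c g₁ g₂ p.1 / R.c g₁ g₂ p.2 : ℂˣ) : ℂ) •
          (twist (N g₂) q w h₂ * twist (N g₁) p q h₁) := by
  have hl := block_comp_mapComp N g₁ g₂ hT
  have hr := block_mapComp_comp N g₁ g₂ hU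
  clear hT hU
  have key : ∀ {l k : ℕ} (x y : ℂˣ) (A B : Matrix (Fin l) (Fin k) ℂ),
      ((x⁻¹ : ℂˣ) : ℂ) • A = ((y⁻¹ : ℂˣ) : ℂ) • B ↔ A = ((x / y : ℂˣ) : ℂ) • B := by
    intro l k x y A B
    rw [← Units.smul_def, ← Units.smul_def, ← Units.smul_def, inv_smul_eq_iff, smul_smul,
      div_eq_mul_inv]
  constructor
  · intro e p q w h₁ h₂ h
    rw [← key, ← hl p w h (Rep.rank_comp_map_comp_map h X), e, hr p q w h₁ h₂ h]
  · intro e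
    refine hom_ext_block fun i j => ?_
    obtain ⟨p, w, h, rfl, rfl⟩ := PairSet.exists_of_fst_snd (R := R) (R' := R') (g₁ * g₂) i j
    have h₂ : MulOpposite.op g₂ • MulOpposite.op g₁ • p = w := by
      rw [← h, MulOpposite.op_mul, mul_smul]
    exact ⟨_, _, Rep.rank_map_comp h X, Rep.rank_comp_map_comp_map h X,
      (hl p w h _).trans (((key _ _ _ _).2 (e p _ w rfl h₂ h)).trans (hr p _ w rfl h₂ h _).symm)⟩

/-! ### Intertwiners as families of matrices -/

theorem matrix_eq_of_eq_zero {k l : ℕ} (h : l = 0) (M N : Matrix (Fin k) (Fin l) ℂ) : M = N := by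
  subst h
  exact Subsingleton.elim _ _

theorem Mor.isIso_of_block {n m : ℕ} {f g : Mor n m} {T : f ⟶ g}
    (h : ∀ i j, ∃ (a b : ℕ) (ha : f.rank i j = a) (hb : g.rank i j = b)
      (B : Matrix (Fin a) (Fin b) ℂ), block T i j ha hb * B = 1 ∧ B * block T i j ha hb = 1) :
    IsIso T := by
  have h' : ∀ i j, ∃ B : Matrix (Fin (f.rank i j)) (Fin (g.rank i j)) ℂ,
      Hom2.entry T i j * B = 1 ∧ B * Hom2.entry T i j = 1 := by
    intro i j
    obtain ⟨a, b, rfl, rfl, B, h⟩ := h i j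
    exact ⟨B, h⟩
  choose B h₁ h₂ using h'
  exact ⟨Hom2.mk B, hom_ext h₂, hom_ext h₁⟩

namespace Intertwiner

/-- The 1-morphism of `2Mat` underlying an intertwiner. -/
noncomputable abbrev mor (η : R.Intertwiner R') : R.obj ⟶ R'.obj := η.app ⟨⟩

/-- The pseudonaturality 2-isomorphisms of an intertwiner. -/
noncomputable abbrev nat (η : R.Intertwiner R') (g : PiZero 𝔾) :
    R.map g ≫ mor η ≅ mor η ≫ R'.map g :=
  η.naturality (a := ⟨⟩) (b := ⟨⟩) g

/-- The rank over a pair `(i', i)` of the 1-morphism underlying an intertwiner. -/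
noncomputable abbrev dim (η : R.Intertwiner R') (p : PairSet R R') : ℕ :=
  TwoMat.rank (mor η) p.1 p.2

/-- The matrices `ℂ^(dim p) → ℂ^(dim q)`, for `q = p · g`, of an intertwiner. -/
noncomputable def matrix (η : R.Intertwiner R') (g : PiZero 𝔾) (p q : PairSet R R')
    (h : MulOpposite.op g • p = q) : Matrix (Fin (dim η q)) (Fin (dim η p)) ℂ :=
  twist (nat η g).hom p q h

theorem matrix_one (η : R.Intertwiner R') (p : PairSet R R')
    (h : MulOpposite.op (1 : PiZero 𝔾) • p = p) : matrix η 1 p p h = 1 :=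
  (naturality_id_iff (nat η 1).hom).1 (η.naturality_id ⟨⟩) p h

theorem matrix_mul (η : R.Intertwiner R') (g₁ g₂ : PiZero 𝔾) (p q w : PairSet R R')
    (h₁ : MulOpposite.op g₁ • p = q) (h₂ : MulOpposite.op g₂ • q = w)
    (h : MulOpposite.op (g₁ * g₂) • p = w) :
    matrix η (g₁ * g₂) p w h = ((R'.c g₁ g₂ p.1 / R.c g₁ g₂ p.2 : ℂˣ) : ℂ) •
      (matrix η g₂ q w h₂ * matrix η g₁ p q h₁) :=
  (naturality_comp_iff (fun g => (nat η g).hom) g₁ g₂ rfl rfl).1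
    (η.naturality_comp (a := ⟨⟩) (b := ⟨⟩) (c := ⟨⟩) g₂ g₁) p q w h₁ h₂ h

/-- On `Aut I` the bijection `γ_I` is the identity. -/
theorem cls_hom (x : Aut (𝟙_ 𝔾)) : cls x.hom = x := by
  rw [cls_eq]
  refine gammaInv_eq ?_
  have h : (λ_ (𝟙_ 𝔾)).hom = (ρ_ (𝟙_ 𝔾)).hom := MonoidalCategory.unitors_equal
  rw [gammaHom, h, MonoidalCategory.rightUnitor_naturality, ← h, Iso.inv_hom_id_assoc]

/-- Over a pair at which `β'` and `β` differ, naturality with respect to `Aut I` makes the identity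
a multiple of itself by two different scalars, so that the rank vanishes. -/
theorem intertwining_of_dim_ne_zero (η : R.Intertwiner R') (p : PairSet R R') (hp : dim η p ≠ 0)
    (x : Aut (𝟙_ 𝔾)) : R'.β x p.1 = R.β x p.2 := by
  have h1 : MulOpposite.op (1 : PiZero 𝔾) • p = p := one_smul _ _
  have h := (naturality_naturality_iff (fun g => (nat η g).hom) x.hom).1
    (η.naturality_naturality (a := ⟨⟩) (b := ⟨⟩) x.hom) p p h1 h1
  have h2 := matrix_one η p h1
  have h3 : twist (nat η (𝟙_ 𝔾)).hom p p h1 = 1 := h2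
  rw [h3, cls_hom] at h
  have : Nonempty (Fin (dim η p)) := ⟨⟨0, Nat.pos_of_ne_zero hp⟩⟩
  obtain ⟨k⟩ := this
  have h4 := congrFun (congrFun h k) k
  simp only [Matrix.smul_apply, Matrix.one_apply_eq, smul_eq_mul, mul_one] at h4
  exact Units.ext h4.symm

end Intertwiner

variable (R R') in
/-- The data to which an intertwiner amounts, up to its gauge: a dimension for each pair
`p = (i', i)`, zero unless `β'_{i'} = β_i`, and matrices `ℂ^(dim p) → ℂ^(dim (p · g))` for
`g ∈ π₀`, multiplicative up to `c' / c`. -/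
structure MatrixSystem where
  dim : PairSet R R' → ℕ
  mat : ∀ (g : PiZero 𝔾) (p q : PairSet R R'), MulOpposite.op g • p = q →
    Matrix (Fin (dim q)) (Fin (dim p)) ℂ
  intertwining : ∀ p, dim p ≠ 0 → ∀ x, R'.β x p.1 = R.β x p.2
  mat_one : ∀ p (h : MulOpposite.op (1 : PiZero 𝔾) • p = p), mat 1 p p h = 1
  mat_mul : ∀ (g₁ g₂ : PiZero 𝔾) (p q w : PairSet R R')
    (h₁ : MulOpposite.op g₁ • p = q) (h₂ : MulOpposite.op g₂ • q = w)
    (h : MulOpposite.op (g₁ * g₂) • p = w),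
    mat (g₁ * g₂) p w h = ((R'.c g₁ g₂ p.1 / R.c g₁ g₂ p.2 : ℂˣ) : ℂ) •
      (mat g₂ q w h₂ * mat g₁ p q h₁)

namespace MatrixSystem

variable (S : MatrixSystem R R')

theorem mat_of_eq_one {k : PiZero 𝔾} (hk : k = 1) (p : PairSet R R')
    (h : MulOpposite.op k • p = p) : S.mat k p p h = 1 := by
  subst hk
  exact S.mat_one p h

/-- The inverse of the matrix of `g` is a multiple of the matrix of `g⁻¹`. -/
theorem exists_inv (g : PiZero 𝔾) (p q : PairSet R R') (h : MulOpposite.op g • p = q) :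
    ∃ B : Matrix (Fin (S.dim p)) (Fin (S.dim q)) ℂ,
      S.mat g p q h * B = 1 ∧ B * S.mat g p q h = 1 := by
  have h' : MulOpposite.op g⁻¹ • q = p := by
    rw [← h, MulOpposite.op_inv, inv_smul_smul]
  have h1 : MulOpposite.op (g * g⁻¹) • p = p := by rw [mul_inv_cancel]; exact one_smul _ _
  have h2 : MulOpposite.op (g⁻¹ * g) • q = q := by rw [inv_mul_cancel]; exact one_smul _ _
  have e1 := (S.mat_mul g g⁻¹ p q p h h' h1).symm.trans (S.mat_of_eq_one (mul_inv_cancel g) p h1)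
  have e2 := (S.mat_mul g⁻¹ g q p q h' h h2).symm.trans (S.mat_of_eq_one (inv_mul_cancel g) q h2)
  rw [← Matrix.smul_mul] at e1
  rw [← Matrix.mul_smul] at e2
  refine ⟨_, ?_, e1⟩
  -- A left inverse of a matrix that has a right inverse is equal to it.
  refine Eq.trans (congrArg _ ?_) e2
  rw [← Matrix.mul_one (_ • S.mat g⁻¹ q p h'), ← e2, ← Matrix.mul_assoc, e1, Matrix.one_mul]

/-- The 1-morphism with the given ranks and trivial gauge. -/
noncomputable def mor : R.obj ⟶ R'.obj := Mor.ofRank fun i j => S.dim (i, j)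

/-- The 2-morphisms with the given matrices. -/
noncomputable def natHom (g : PiZero 𝔾) : R.map g ≫ S.mor ⟶ S.mor ≫ R'.map g :=
  ofTwist (X := S.mor) (Y := S.mor) (S.mat g)

theorem twist_natHom (g : PiZero 𝔾) (p q : PairSet R R') (h : MulOpposite.op g • p = q) :
    twist (S.natHom g) p q h = S.mat g p q h :=
  twist_ofTwist (X := S.mor) (Y := S.mor) (S.mat g) p q h

theorem isIso_natHom (g : PiZero 𝔾) : IsIso (S.natHom g) := by
  refine Mor.isIso_of_block fun i j => ?_
  obtain ⟨p, q, h, rfl, rfl⟩ := PairSet.exists_of_fst_snd (R := R) (R' := R') g i j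
  obtain ⟨B, hB⟩ := S.exists_inv g p q h
  rw [← twist_natHom] at hB
  exact ⟨_, _, Rep.rank_map_comp h S.mor, Rep.rank_comp_map h S.mor, B, hB⟩

/-- The 2-isomorphisms with the given matrices. -/
noncomputable def natIso (g : PiZero 𝔾) : R.map g ≫ S.mor ≅ S.mor ≫ R'.map g :=
  @asIso _ _ _ _ (S.natHom g) (S.isIso_natHom g)

theorem natHom_naturality {f g : 𝔾} (η : f ⟶ g) :
    R.map₂ (𝔾 := 𝔾) η ▷ S.mor ≫ S.natHom g = S.natHom f ≫ S.mor ◁ R'.map₂ (𝔾 := 𝔾) η := by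
  refine (naturality_naturality_iff S.natHom η).2 fun p q hf hg => ?_
  obtain rfl : f = g := eq_of_hom (𝔾 := 𝔾) η
  by_cases hp : S.dim p = 0
  · exact matrix_eq_of_eq_zero hp _ _
  · rw [S.intertwining p hp]

/-- The intertwiner with the given matrices. -/
noncomputable def toIntertwiner : R.Intertwiner R' :=
  Pseudofunctor.StrongTrans.mk (F := R.toPseudofunctor) (G := R'.toPseudofunctor)
    (fun _ => S.mor)
    (fun g => S.natIso g)
    (fun η => S.natHom_naturality η)
    (fun _ => (naturality_id_iff (S.natHom 1)).2 fun p h =>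
      (S.twist_natHom 1 p p h).trans (S.mat_one p h))
    (fun g₂ g₁ => (naturality_comp_iff S.natHom g₁ g₂ rfl rfl).2 fun p q w h₁ h₂ h =>
      (S.twist_natHom _ p w h).trans ((S.mat_mul g₁ g₂ p q w h₁ h₂ h).trans
        (congrArg₂ (fun M N => _ • (M * N)) (S.twist_natHom g₂ q w h₂).symm
          (S.twist_natHom g₁ p q h₁).symm)))

theorem matrix_toIntertwiner (g : PiZero 𝔾) (p q : PairSet R R') (h : MulOpposite.op g • p = q) :
    Intertwiner.matrix S.toIntertwiner g p q h = S.mat g p q h :=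
  S.twist_natHom g p q h

end MatrixSystem

/-! ### The bundles of an intertwiner -/

namespace PBund
variable {G X : Type*} [Group G] [MulAction Gᵐᵒᵖ X] {z : TwoCocycle G X}

theorem hom_ext {E F : PBund G X z} {T U : E ⟶ F} (h : ∀ x, Hom.app T x = Hom.app U x) : T = U :=
  Hom.ext (funext h)

/-- A family of linear isomorphisms commuting with the projective actions is an isomorphism. -/
def isoMk {E F : PBund G X z} (e : ∀ x, E.fiber x ≃ₗ[ℂ] F.fiber x)
    (comm : ∀ (g : G) (x y : X) (h : MulOpposite.op g • x = y) (v : E.fiber x),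
      e y (E.act g x y h v) = F.act g x y h (e x v)) : E ≅ F where
  hom := Hom.mk (fun x => (e x).toLinearMap) comm
  inv := Hom.mk (fun x => (e x).symm.toLinearMap) fun g x y h v => by
    change (e y).symm _ = E.act g x y h ((e x).symm v)
    rw [LinearEquiv.symm_apply_eq, comm, LinearEquiv.apply_symm_apply]
  hom_inv_id := hom_ext fun x => LinearMap.ext fun v => (e x).symm_apply_apply v
  inv_hom_id := hom_ext fun x => LinearMap.ext fun v => (e x).apply_symm_apply v

end PBund

namespace IntertwiningOrbit

theorem eq_of_mem {O O' : IntertwiningOrbit R R'} {p : PairSet R R'} (h : p ∈ O.1.orbit)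
    (h' : p ∈ O'.1.orbit) : O = O' :=
  Subtype.ext (((MulAction.orbitRel.Quotient.mem_orbit).1 h).symm.trans
    ((MulAction.orbitRel.Quotient.mem_orbit).1 h'))

theorem mem_of_smul_eq {O : IntertwiningOrbit R R'} {g : PiZero 𝔾} {p q : PairSet R R'}
    (h : MulOpposite.op g • p = q) (hp : p ∈ O.1.orbit) : q ∈ O.1.orbit := by
  rw [← h, MulAction.orbitRel.Quotient.mem_orbit] at *
  rw [← hp]
  exact Quotient.sound ⟨MulOpposite.op g, rfl⟩

/-- The condition `β'_{i'} = β_i` is invariant under the action of `π₀`, because `β` and `β'` are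
morphisms of `π₀`-modules. -/
theorem exists_mem {p : PairSet R R'} (hp : ∀ x : Aut (𝟙_ 𝔾), R'.β x p.1 = R.β x p.2) :
    ∃ O : IntertwiningOrbit R R', p ∈ O.1.orbit := by
  refine ⟨⟨Quotient.mk _ p, ?_⟩, MulAction.orbitRel.Quotient.mem_orbit.2 rfl⟩
  intro q hq x
  obtain ⟨g, rfl⟩ : ∃ g : (PiZero 𝔾)ᵐᵒᵖ, g • p = q :=
    Quotient.exact (MulAction.orbitRel.Quotient.mem_orbit.1 hq)
  exact (R'.β_act g.unop x p.1).symm.trans ((hp _).trans (R.β_act g.unop x p.2))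

end IntertwiningOrbit

namespace Intertwiner

theorem exists_mem_of_dim_ne_zero (η : R.Intertwiner R') {p : PairSet R R'} (hp : dim η p ≠ 0) :
    ∃ O : IntertwiningOrbit R R', p ∈ O.1.orbit :=
  IntertwiningOrbit.exists_mem (intertwining_of_dim_ne_zero η p hp)

/-- The bundle over an intertwining orbit with fibres `ℂ^(dim p)`, on which `π₀` acts by
the matrices of the intertwiner. -/
noncomputable def bundle (η : R.Intertwiner R') (O : IntertwiningOrbit R R') :
    PBund (PiZero 𝔾) O.1.orbit (orbitCocycle R R' O) where
  fiber x := Fin (dim η x.1) → ℂ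
  act g x y h := (matrix η g x.1 y.1 (congrArg Subtype.val h)).mulVecLin
  act_one x h e := by
    exact (congrArg (fun M => M *ᵥ e) (matrix_one η x.1 _)).trans (Matrix.one_mulVec e)
  act_mul g₁ g₂ x y w h₁ h₂ h e := by
    refine (congrArg (fun M => M *ᵥ e) (matrix_mul η g₁ g₂ x.1 y.1 w.1 (congrArg Subtype.val h₁)
      (congrArg Subtype.val h₂) (congrArg Subtype.val h))).trans ?_
    exact (Matrix.smul_mulVec _ _ _).trans (congrArg _ (Matrix.mulVec_mulVec _ _ _).symm)

/-- The entries of a modification. -/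
noncomputable abbrev entry {η θ : R.Intertwiner R'} (Γ : η ⟶ θ) (p : PairSet R R') :
    Matrix (Fin (dim θ p)) (Fin (dim η p)) ℂ :=
  Hom2.entry (Pseudofunctor.StrongTrans.Modification.app
    (Pseudofunctor.StrongTrans.Hom.as Γ) ⟨⟩) p.1 p.2

theorem entry_mul_matrix {η θ : R.Intertwiner R'} (Γ : η ⟶ θ) (g : PiZero 𝔾) (p q : PairSet R R')
    (h : MulOpposite.op g • p = q) :
    entry Γ q * matrix η g p q h = matrix θ g p q h * entry Γ p :=
  (modification_naturality_iff (nat η g).hom (nat θ g).hom _).1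
    (Pseudofunctor.StrongTrans.Modification.naturality
      (Pseudofunctor.StrongTrans.Hom.as Γ) (a := ⟨⟩) (b := ⟨⟩) g) p q h

theorem hom_ext_entry {η θ : R.Intertwiner R'} {Γ Ψ : η ⟶ θ} (h : ∀ p, entry Γ p = entry Ψ p) :
    Γ = Ψ :=
  Pseudofunctor.StrongTrans.homCategory.ext fun _ => Mor.hom_ext fun i j => h (i, j)

/-- Matrices that intertwine those of `η` and `θ` are the entries of a modification. -/
theorem exists_entry_eq {η θ : R.Intertwiner R'}
    (M : ∀ p, Matrix (Fin (dim θ p)) (Fin (dim η p)) ℂ)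
    (h : ∀ (g : PiZero 𝔾) p q (h : MulOpposite.op g • p = q),
      M q * matrix η g p q h = matrix θ g p q h * M p) :
    ∃ Γ : η ⟶ θ, ∀ p, entry Γ p = M p :=
  ⟨Pseudofunctor.StrongTrans.Hom.of
    { app := fun _ => (Hom2.mk fun i j => M (i, j) : mor η ⟶ mor θ)
      naturality := fun g =>
        (modification_naturality_iff (nat η g).hom (nat θ g).hom _).2 (h g) }, fun _ => rfl⟩

/-- The morphism of bundles given by the entries of a modification. -/
noncomputable def bundleMap {η θ : R.Intertwiner R'} (Γ : η ⟶ θ) (O : IntertwiningOrbit R R') :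
    bundle η O ⟶ bundle θ O :=
  PBund.Hom.mk (fun x => (entry Γ x.1).mulVecLin) fun g x y h e => by
    have h' := congrArg (fun M => M *ᵥ e) (entry_mul_matrix Γ g x.1 y.1 (congrArg Subtype.val h))
    exact (Matrix.mulVec_mulVec e _ _).trans (h'.trans (Matrix.mulVec_mulVec e _ _).symm)

variable (R R') in
/-- The functor taking an intertwiner to its bundles over the intertwining orbits. -/
noncomputable def toBundles : R.Intertwiner R' ⥤
    ∀ O : IntertwiningOrbit R R', PBund (PiZero 𝔾) O.1.orbit (orbitCocycle R R' O) where
  obj η := bundle η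
  map Γ := bundleMap Γ
  map_id _ := funext fun _ => PBund.hom_ext fun _ => Matrix.mulVecLin_one
  map_comp _ _ := funext fun _ => PBund.hom_ext fun _ => Matrix.mulVecLin_mul _ _

/-- A modification has no entries outside the intertwining orbits. -/
instance : (toBundles R R').Faithful where
  map_injective {η θ Γ Ψ} h := hom_ext_entry fun p => by
    by_cases hp : dim η p = 0
    · exact matrix_eq_of_eq_zero hp _ _
    · obtain ⟨O, hO⟩ := exists_mem_of_dim_ne_zero η hp
      have h' := congrArg (fun T => PBund.Hom.app T ⟨p, hO⟩) (congrFun h O)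
      exact Matrix.toLin'.injective h'

instance : (toBundles R R').Full where
  map_surjective {η θ} T := by
    -- The orbit through `p` is unique if it exists, so that the matrix at `p` can be
    -- chosen to work for all `O` containing `p`; this avoids transport between equal orbits.
    have hM : ∀ p : PairSet R R', ∃ M : Matrix (Fin (dim θ p)) (Fin (dim η p)) ℂ,
        ∀ (O : IntertwiningOrbit R R') (hp : p ∈ O.1.orbit),
          M.mulVecLin = PBund.Hom.app (T O) ⟨p, hp⟩ := by
      intro p
      by_cases h : ∃ O : IntertwiningOrbit R R', p ∈ O.1.orbit
      · obtain ⟨O, hO⟩ := h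
        refine ⟨LinearMap.toMatrix' (PBund.Hom.app (T O) ⟨p, hO⟩), fun O' hp => ?_⟩
        obtain rfl := IntertwiningOrbit.eq_of_mem hO hp
        exact Matrix.toLin'_toMatrix' _
      · exact ⟨0, fun O hp => (h ⟨O, hp⟩).elim⟩
    choose M hM using hM
    obtain ⟨Γ, hΓ⟩ := exists_entry_eq (η := η) (θ := θ) M (by
      intro g p q h
      by_cases hp : dim η p = 0
      · exact matrix_eq_of_eq_zero hp _ _
      · obtain ⟨O, hO⟩ := exists_mem_of_dim_ne_zero η hp
        have hq := IntertwiningOrbit.mem_of_smul_eq h hO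
        apply Matrix.toLin'.injective
        refine LinearMap.ext fun e => ?_
        have hc := PBund.Hom.comm (T O) g ⟨p, hO⟩ ⟨q, hq⟩ (Subtype.ext h) e
        rw [← hM q O hq, ← hM p O hO] at hc
        simp only [Matrix.toLin'_apply, ← Matrix.mulVec_mulVec]
        exact hc)
    refine ⟨Γ, funext fun O => PBund.hom_ext fun x => ?_⟩
    rw [← hM x.1 O x.2, ← hΓ]
    rfl

/-- In coordinates, a linear map is the multiplication by its matrix. -/
theorem toMatrix_mulVec_eq {k l : ℕ} {V W : Type*} [AddCommGroup V] [Module ℂ V] [AddCommGroup W]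
    [Module ℂ W] (b : Module.Basis (Fin k) ℂ V) (b' : Module.Basis (Fin l) ℂ W) (f : V →ₗ[ℂ] W)
    (v : Fin k → ℂ) :
    LinearMap.toMatrix b b' f *ᵥ v = b'.equivFun (f (b.equivFun.symm v)) := by
  have := LinearMap.toMatrix_mulVec_repr b b' f (b.equivFun.symm v)
  rwa [← Module.Basis.equivFun_apply, LinearEquiv.apply_symm_apply,
    ← Module.Basis.equivFun_apply] at this

/-- Bases of the fibres of a family of bundles turn its projective actions into a matrix system,
hence into an intertwiner. -/
instance : (toBundles R R').EssSurj where
  mem_essImage E := by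
    -- The ranks are the dimensions of the fibres, and `0` outside the intertwining orbits.
    have hd : ∀ p : PairSet R R', ∃ d : ℕ,
        (d ≠ 0 → ∃ O : IntertwiningOrbit R R', p ∈ O.1.orbit) ∧
        ∀ (O : IntertwiningOrbit R R') (hp : p ∈ O.1.orbit),
          Module.finrank ℂ ((E O).fiber ⟨p, hp⟩) = d := by
      intro p
      by_cases h : ∃ O : IntertwiningOrbit R R', p ∈ O.1.orbit
      · obtain ⟨O, hO⟩ := h
        refine ⟨Module.finrank ℂ ((E O).fiber ⟨p, hO⟩), fun _ => ⟨O, hO⟩, fun O' hp => ?_⟩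
        obtain rfl := IntertwiningOrbit.eq_of_mem hO hp
        rfl
      · exact ⟨0, fun h0 => (h0 rfl).elim, fun O hp => (h ⟨O, hp⟩).elim⟩
    choose d hd₀ hd using hd
    let b := fun (O : IntertwiningOrbit R R') (p : PairSet R R') (hp : p ∈ O.1.orbit) =>
      Module.finBasisOfFinrankEq ℂ ((E O).fiber ⟨p, hp⟩) (hd p O hp)
    -- The matrices of the projective actions in the bases `b`.
    have hA : ∀ (g : PiZero 𝔾) (p q : PairSet R R') (h : MulOpposite.op g • p = q),
        ∃ A : Matrix (Fin (d q)) (Fin (d p)) ℂ,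
          ∀ (O : IntertwiningOrbit R R') (hp : p ∈ O.1.orbit) (hq : q ∈ O.1.orbit),
            A = LinearMap.toMatrix (b O p hp) (b O q hq)
              ((E O).act g ⟨p, hp⟩ ⟨q, hq⟩ (Subtype.ext h)) := by
      intro g p q h
      by_cases hO : ∃ O : IntertwiningOrbit R R', p ∈ O.1.orbit
      · obtain ⟨O, hO⟩ := hO
        refine ⟨LinearMap.toMatrix (b O p hO) (b O q (IntertwiningOrbit.mem_of_smul_eq h hO))
          ((E O).act g ⟨p, hO⟩ ⟨q, IntertwiningOrbit.mem_of_smul_eq h hO⟩ (Subtype.ext h)),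
          fun O' hp hq => ?_⟩
        obtain rfl := IntertwiningOrbit.eq_of_mem hO hp
        rfl
      · exact ⟨0, fun O hp => (hO ⟨O, hp⟩).elim⟩
    choose A hA using hA
    let S : MatrixSystem R R' :=
      { dim := d
        mat := A
        intertwining := fun p hp => by
          obtain ⟨O, hO⟩ := hd₀ p hp
          exact O.2 p hO
        mat_one := fun p h => by
          by_cases hp : d p = 0
          · exact matrix_eq_of_eq_zero hp _ _
          obtain ⟨O, hO⟩ := hd₀ p hp
          rw [hA 1 p p h O hO hO, ← LinearMap.toMatrix_id (b O p hO)]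
          exact congrArg _ (LinearMap.ext fun e => (E O).act_one _ _ e)
        mat_mul := fun g₁ g₂ p q w h₁ h₂ h => by
          by_cases hp : d p = 0
          · exact matrix_eq_of_eq_zero hp _ _
          obtain ⟨O, hO⟩ := hd₀ p hp
          have hq := IntertwiningOrbit.mem_of_smul_eq h₁ hO
          have hw := IntertwiningOrbit.mem_of_smul_eq h₂ hq
          rw [hA _ p w h O hO hw, hA _ p q h₁ O hO hq, hA _ q w h₂ O hq hw,
            ← LinearMap.toMatrix_comp, ← map_smul]
          exact congrArg _ (LinearMap.ext fun e =>
            (E O).act_mul g₁ g₂ ⟨p, hO⟩ ⟨q, hq⟩ ⟨w, hw⟩ _ _ _ e) }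
    let e := fun O => PBund.isoMk (E := bundle S.toIntertwiner O) (F := E O)
      (fun x => (b O x.1 x.2).equivFun.symm) (fun g x y h v => by
        refine ((b O y.1 y.2).equivFun.symm_apply_eq).2 ?_
        change matrix S.toIntertwiner g x.1 y.1 _ *ᵥ v = _
        have hM := (S.matrix_toIntertwiner g x.1 y.1 (congrArg Subtype.val h)).trans
          (hA g x.1 y.1 _ O x.2 y.2)
        refine (congrArg (fun M => M *ᵥ v) hM).trans ?_
        exact toMatrix_mulVec_eq (b O x.1 x.2) (b O y.1 y.2) ((E O).act g x y h) v)
    exact ⟨S.toIntertwiner, ⟨{ hom := fun O => (e O).hom, inv := fun O => (e O).inv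
                               hom_inv_id := funext fun O => (e O).hom_inv_id
                               inv_hom_id := funext fun O => (e O).inv_hom_id }⟩⟩

end Intertwiner

/-- The product of an empty family of categories is terminal. -/
noncomputable def piEquivalenceOfIsEmpty {I : Type*} [IsEmpty I] (C : I → Type*)
    [∀ i, Category (C i)] : (∀ i, C i) ≌ Discrete PUnit.{1} where
  functor := Functor.star _
  inverse := (Functor.const _).obj isEmptyElim
  unitIso := NatIso.ofComponents (fun _ =>
    { hom := isEmptyElim
      inv := isEmptyElim
      hom_inv_id := funext isEmptyElim
      inv_hom_id := funext isEmptyElim }) (fun _ => funext isEmptyElim)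
  counitIso := Functor.punitExt _ _
  functor_unitIso_comp _ := Subsingleton.elim _ _

end TwoRep

theorem mainTheorem3 {𝔾 : Type u} [Category.{v} 𝔾] [MonoidalCategory 𝔾] [SpecialTwoGroup 𝔾]
    (R R' : Rep 𝔾) :
    Nonempty (R.Intertwiner R' ≌
      ∀ O : IntertwiningOrbit R R', PBund (PiZero 𝔾) O.1.orbit (orbitCocycle R R' O)) ∧
    (IsEmpty (IntertwiningOrbit R R') →
      Nonempty (R.Intertwiner R' ≌ Discrete PUnit.{1})) := by
  have : (Intertwiner.toBundles R R').IsEquivalence := {}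
  refine ⟨⟨(Intertwiner.toBundles R R').asEquivalence⟩, fun _ => ?_⟩
  exact ⟨(Intertwiner.toBundles R R').asEquivalence.trans (piEquivalenceOfIsEmpty _)⟩
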